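/- Let $R$ be a commutative ring, let $C$ and $D$ be (coassociative, counital) $R$-coalgebras that are flat as $R$-modules, and let $\mathcal M^C$, ${}^C\mathcal M$ denote the categories of right and left $C$-comodules with colinear maps (similarly for $D$). For a right $D$-comodule $X$ and a left $D$-comodule $P$ the cotensor product is $$X\,\square_D\,P=\ker\bigl(\varrho_X\otimes \mathrm{id}_P-\mathrm{id}_X\otimes\varrho_P : X\otimes_R P\to X\otimes_R D\otimes_R P\bigr);$$ if $X$ is a $C$-$D$-bicomodule, this is a left $C$-comodule by restricting $\varrho^-_X\otimes\mathrm{id}_P$, where $\varrho^-_X: X\to C\otimes_R X$ is the left coaction of $X$, and $X\,\square_D-$ is a functor ${}^D\mathcal M\to{}^C\mathcal M$. For an $R$-linear functor $F:\mathcal M^C\to\mathcal M^D$ and an $R$-module $W$ let $$\lambda^F_{W}: W\otimes_R F(C)\to F(W\otimes_R C),\qquad w\otimes x\mapsto F\bigl(c\mapsto w\otimes c\bigr)(x),$$ where $W\otimes_R C$ is a right $C$-comodule through $\mathrm{id}_W\otimes\Delta$. **Theorem.** Let $F:\mathcal M^C\to\mathcal M^D$ be an $R$-linear equivalence of categories with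 inverse $G:\mathcal M^D\to\mathcal M^C$. Then $\lambda^F_C: C\otimes_R F(C)\to F(C\otimes_R C)$ and $\lambda^G_D: D\otimes_R G(D)\to G(D\otimes_R D)$ are bijective; the maps $(\lambda^F_C)^{-1}\circ F(\Delta_C)$ and $(\lambda^G_D)^{-1}\circ G(\Delta_D)$ are left coactions making $F(C)$ a $C$-$D$-bicomodule and $G(D)$ a $D$-$C$-bicomodule; and the functor $$F(C)\,\square_D-\;:\;{}^D\mathcal M\to{}^C\mathcal M$$ is an $R$-linear equivalence of categories with inverse $G(D)\,\square_C-:{}^C\mathcal M\to{}^D\mathcal M$. In particular, if $\mathcal M^C$ is ($R$-linearly) equivalent to $\mathcal M^D$, then ${}^C\mathcal M$ is ($R$-linearly) equivalent to ${}^D\mathcal M$. -/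

import Mathlib

open CategoryTheory
open scoped TensorProduct

universe u

namespace MoritaTakeuchi

/-- A right coaction `ρ : M → M ⊗ C` of a coalgebra `C` on an `R`-module `M`. -/
structure RightCoaction (R C M : Type u) [CommRing R] [AddCommGroup C] [Module R C]
    [Coalgebra R C] [AddCommGroup M] [Module R M] where
  /-- the structure map -/
  map : M →ₗ[R] M ⊗[R] C
  coassoc : (TensorProduct.assoc R M C C).toLinearMap ∘ₗ map.rTensor C ∘ₗ map =
    (Coalgebra.comul (R := R) (A := C)).lTensor M ∘ₗ map
  counit : (TensorProduct.rid R M).toLinearMap ∘ₗ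
    (Coalgebra.counit (R := R) (A := C)).lTensor M ∘ₗ map = LinearMap.id

/-- A left coaction `ρ : M → C ⊗ M` of a coalgebra `C` on an `R`-module `M`. -/
structure LeftCoaction (R C M : Type u) [CommRing R] [AddCommGroup C] [Module R C]
    [Coalgebra R C] [AddCommGroup M] [Module R M] where
  /-- the structure map -/
  map : M →ₗ[R] C ⊗[R] M
  coassoc : map.lTensor C ∘ₗ map = (TensorProduct.assoc R C C M).toLinearMap ∘ₗ
    (Coalgebra.comul (R := R) (A := C)).rTensor M ∘ₗ map
  counit : (TensorProduct.lid R M).toLinearMap ∘ₗ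
    (Coalgebra.counit (R := R) (A := C)).rTensor M ∘ₗ map = LinearMap.id

/-- Right `C`-comodules. -/
structure RightComod (R C : Type u) [CommRing R] [AddCommGroup C] [Module R C]
    [Coalgebra R C] where
  /-- the underlying `R`-module -/
  carrier : Type u
  [addCommGroup : AddCommGroup carrier]
  [module : Module R carrier]
  /-- the coaction -/
  coaction : RightCoaction R C carrier

/-- Left `C`-comodules. -/
structure LeftComod (R C : Type u) [CommRing R] [AddCommGroup C] [Module R C]
    [Coalgebra R C] where
  /-- the underlying `R`-module -/
  carrier : Type u
  [addCommGroup : AddCommGroup carrier]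
  [module : Module R carrier]
  /-- the coaction -/
  coaction : LeftCoaction R C carrier

attribute [instance] RightComod.addCommGroup RightComod.module
  LeftComod.addCommGroup LeftComod.module

section Categories

variable {R C : Type u} [CommRing R] [AddCommGroup C] [Module R C] [Coalgebra R C]

/-- The `R`-module of `C`-colinear maps between right comodules. -/
def RightComod.colinear (M N : RightComod R C) : Submodule R (M.carrier →ₗ[R] N.carrier) where
  carrier := {f | N.coaction.map ∘ₗ f = f.rTensor C ∘ₗ M.coaction.map}
  add_mem' {f g} hf hg := by
    simp only [Set.mem_ofPred_eq] at hf hg ⊢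
    rw [LinearMap.comp_add, hf, hg, LinearMap.rTensor_add, LinearMap.add_comp]
  zero_mem' := by simp
  smul_mem' r f hf := by
    simp only [Set.mem_ofPred_eq] at hf ⊢
    rw [LinearMap.comp_smul, hf, LinearMap.rTensor_smul, LinearMap.smul_comp]

/-- The `R`-module of `C`-colinear maps between left comodules. -/
def LeftComod.colinear (M N : LeftComod R C) : Submodule R (M.carrier →ₗ[R] N.carrier) where
  carrier := {f | N.coaction.map ∘ₗ f = f.lTensor C ∘ₗ M.coaction.map}
  add_mem' {f g} hf hg := by
    simp only [Set.mem_ofPred_eq] at hf hg ⊢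
    rw [LinearMap.comp_add, hf, hg, LinearMap.lTensor_add, LinearMap.add_comp]
  zero_mem' := by simp
  smul_mem' r f hf := by
    simp only [Set.mem_ofPred_eq] at hf ⊢
    rw [LinearMap.comp_smul, hf, LinearMap.lTensor_smul, LinearMap.smul_comp]

/-- The category `M^C` of right `C`-comodules and colinear maps. -/
instance : Category.{u} (RightComod R C) where
  Hom M N := RightComod.colinear M N
  id M := ⟨LinearMap.id, by simp [RightComod.colinear]⟩
  comp {M N P} f g := ⟨g.1 ∘ₗ f.1, by
    have hf : _ = _ := f.2
    have hg : _ = _ := g.2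
    change _ = _
    rw [← LinearMap.comp_assoc, hg, LinearMap.comp_assoc, hf, LinearMap.rTensor_comp,
      LinearMap.comp_assoc]⟩

/-- The category `^C M` of left `C`-comodules and colinear maps. -/
instance : Category.{u} (LeftComod R C) where
  Hom M N := LeftComod.colinear M N
  id M := ⟨LinearMap.id, by simp [LeftComod.colinear]⟩
  comp {M N P} f g := ⟨g.1 ∘ₗ f.1, by
    have hf : _ = _ := f.2
    have hg : _ = _ := g.2
    change _ = _
    rw [← LinearMap.comp_assoc, hg, LinearMap.comp_assoc, hf, LinearMap.lTensor_comp,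
      LinearMap.comp_assoc]⟩

/-- The `R`-linear map underlying a morphism of right comodules. -/
def RightComod.lin {M N : RightComod R C} (f : M ⟶ N) : M.carrier →ₗ[R] N.carrier := f.1

/-- The `R`-linear map underlying a morphism of left comodules. -/
def LeftComod.lin {M N : LeftComod R C} (f : M ⟶ N) : M.carrier →ₗ[R] N.carrier := f.1

instance : Preadditive (RightComod R C) where
  homGroup M N := inferInstanceAs (AddCommGroup (RightComod.colinear M N))
  add_comp _ _ _ _ _ _ := Subtype.ext (LinearMap.comp_add _ _ _)
  comp_add _ _ _ _ _ _ := Subtype.ext (LinearMap.add_comp _ _ _)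

instance : Preadditive (LeftComod R C) where
  homGroup M N := inferInstanceAs (AddCommGroup (LeftComod.colinear M N))
  add_comp _ _ _ _ _ _ := Subtype.ext (LinearMap.comp_add _ _ _)
  comp_add _ _ _ _ _ _ := Subtype.ext (LinearMap.add_comp _ _ _)

instance : Linear R (RightComod R C) where
  homModule M N := inferInstanceAs (Module R (RightComod.colinear M N))
  smul_comp _ _ _ _ _ _ := Subtype.ext (LinearMap.comp_smul _ _ _)
  comp_smul _ _ _ _ _ _ := Subtype.ext (LinearMap.smul_comp _ _ _)

instance : Linear R (LeftComod R C) where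
  homModule M N := inferInstanceAs (Module R (LeftComod.colinear M N))
  smul_comp _ _ _ _ _ _ := Subtype.ext (LinearMap.comp_smul _ _ _)
  comp_smul _ _ _ _ _ _ := Subtype.ext (LinearMap.smul_comp _ _ _)

end Categories

section Free

variable {R : Type u} [CommRing R]

variable (R) in
/-- `C` as a right comodule over itself, with coaction `Δ`. -/
abbrev regular (C : Type u) [AddCommGroup C] [Module R C] [Coalgebra R C] : RightComod R C where
  carrier := C
  coaction :=
    { map := Coalgebra.comul
      coassoc := Coalgebra.coassoc
      counit := by
        ext c
        simp }

variable {C : Type u} [AddCommGroup C] [Module R C] [Coalgebra R C]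

/-- `W ⊗ M` for an `R`-module `W` and a right `C`-comodule `M`, with the coaction
`id_W ⊗ ρ_M`. -/
abbrev tensorRight (W : Type u) [AddCommGroup W] [Module R W] (M : RightComod R C) :
    RightComod R C where
  carrier := W ⊗[R] M.carrier
  coaction :=
    { map := (TensorProduct.assoc R W M.carrier C).symm.toLinearMap ∘ₗ
        M.coaction.map.lTensor W
      coassoc := by
        ext w m
        have h := LinearMap.congr_fun M.coaction.coassoc m
        simp only [LinearMap.comp_apply, LinearEquiv.coe_coe] at h
        have h1 : ∀ t : M.carrier ⊗[R] C,
            TensorProduct.assoc R (W ⊗[R] M.carrier) C C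
              (((TensorProduct.assoc R W M.carrier C).symm.toLinearMap ∘ₗ
                M.coaction.map.lTensor W).rTensor C
                ((TensorProduct.assoc R W M.carrier C).symm (w ⊗ₜ t))) =
            (TensorProduct.assoc R W M.carrier (C ⊗[R] C)).symm
              (w ⊗ₜ TensorProduct.assoc R M.carrier C C (M.coaction.map.rTensor C t)) := by
          intro t
          induction t with
          | zero => simp
          | add a b ha hb => simp only [TensorProduct.tmul_add, map_add, ha, hb]
          | tmul m' c =>
            simp only [TensorProduct.assoc_symm_tmul, LinearMap.rTensor_tmul,
              LinearMap.comp_apply, LinearMap.lTensor_tmul, LinearEquiv.coe_coe]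
            generalize M.coaction.map m' = t
            induction t with
            | zero => simp
            | add a b ha hb => simp only [TensorProduct.tmul_add, TensorProduct.add_tmul,
                map_add, ha, hb]
            | tmul m'' c' => simp
        have h2 : ∀ t : M.carrier ⊗[R] C,
            (Coalgebra.comul (R := R) (A := C)).lTensor (W ⊗[R] M.carrier)
                ((TensorProduct.assoc R W M.carrier C).symm (w ⊗ₜ t)) =
            (TensorProduct.assoc R W M.carrier (C ⊗[R] C)).symm
              (w ⊗ₜ (Coalgebra.comul (R := R) (A := C)).lTensor M.carrier t) := by
          intro t
          induction t with
          | zero => simp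
          | add a b ha hb => simp only [TensorProduct.tmul_add, map_add, ha, hb]
          | tmul m' c => simp
        simp only [TensorProduct.AlgebraTensorModule.curry_apply, TensorProduct.curry_apply,
          LinearMap.coe_restrictScalars, LinearMap.comp_apply, LinearEquiv.coe_coe,
          LinearMap.lTensor_tmul]
        rw [h1, h2, h]
      counit := by
        ext w m
        have h := LinearMap.congr_fun M.coaction.counit m
        simp only [LinearMap.comp_apply, LinearEquiv.coe_coe, LinearMap.id_apply] at h
        have h1 : ∀ t : M.carrier ⊗[R] C,
            TensorProduct.rid R (W ⊗[R] M.carrier)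
              ((Coalgebra.counit (R := R) (A := C)).lTensor (W ⊗[R] M.carrier)
                ((TensorProduct.assoc R W M.carrier C).symm (w ⊗ₜ t))) =
            w ⊗ₜ TensorProduct.rid R M.carrier
              ((Coalgebra.counit (R := R) (A := C)).lTensor M.carrier t) := by
          intro t
          induction t with
          | zero => simp
          | add a b ha hb => simp only [TensorProduct.tmul_add, map_add, ha, hb]
          | tmul m' c => simp
        simp only [TensorProduct.AlgebraTensorModule.curry_apply, TensorProduct.curry_apply,
          LinearMap.coe_restrictScalars, LinearMap.comp_apply, LinearEquiv.coe_coe,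
          LinearMap.lTensor_tmul, LinearMap.id_apply]
        rw [h1, h] }

/-- The colinear map `W → Hom(M, W ⊗ M)`, `w ↦ (m ↦ w ⊗ m)`. -/
def insertion (W : Type u) [AddCommGroup W] [Module R W] (M : RightComod R C) :
    W →ₗ[R] (M ⟶ tensorRight W M) where
  toFun w := ⟨TensorProduct.mk R W M.carrier w, by
    change (TensorProduct.assoc R W M.carrier C).symm.toLinearMap ∘ₗ M.coaction.map.lTensor W ∘ₗ
      TensorProduct.mk R W M.carrier w =
      (TensorProduct.mk R W M.carrier w).rTensor C ∘ₗ M.coaction.map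
    ext m
    simp only [LinearMap.comp_apply, TensorProduct.mk_apply, LinearEquiv.coe_coe,
      LinearMap.lTensor_tmul]
    generalize M.coaction.map m = t
    induction t with
    | zero => simp
    | add a b ha hb => simp only [TensorProduct.tmul_add, map_add, ha, hb]
    | tmul m' c => simp⟩
  map_add' w w' := Subtype.ext (map_add (TensorProduct.mk R W M.carrier) w w')
  map_smul' r w := Subtype.ext (map_smul (TensorProduct.mk R W M.carrier) r w)

variable (R C) in
/-- The comultiplication as a morphism of right comodules `C ⟶ C ⊗ C`. -/
def comulHom : regular R C ⟶ tensorRight C (regular R C) :=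
  ⟨Coalgebra.comul (R := R) (A := C), by
    change (TensorProduct.assoc R C C C).symm.toLinearMap ∘ₗ
      (Coalgebra.comul (R := R) (A := C)).lTensor C ∘ₗ Coalgebra.comul (R := R) (A := C) =
      (Coalgebra.comul (R := R) (A := C)).rTensor C ∘ₗ Coalgebra.comul (R := R) (A := C)
    rw [← Coalgebra.coassoc]
    ext c
    simp⟩

end Free

section Lambda

variable {R C D : Type u} [CommRing R] [AddCommGroup C] [Module R C] [Coalgebra R C]
  [AddCommGroup D] [Module R D] [Coalgebra R D]

/-- `f ↦ (underlying linear map of f)` as a linear map. -/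
def RightComod.linₗ (M N : RightComod R C) : (M ⟶ N) →ₗ[R] (M.carrier →ₗ[R] N.carrier) :=
  (RightComod.colinear M N).subtype

/-- For an `R`-linear functor `F : M^C ⥤ M^D`, the canonical map
`λ_{W,M} : W ⊗ F(M) → F(W ⊗ M)`, `w ⊗ x ↦ F(m ↦ w ⊗ m)(x)`; it is the natural
transformation in `W` which for `W = R` is the canonical isomorphism
`R ⊗ F(M) ≅ F(M) ≅ F(R ⊗ M)`. -/
def lam (F : RightComod R C ⥤ RightComod R D) [F.Additive] [F.Linear R]
    (W : Type u) [AddCommGroup W] [Module R W] (M : RightComod R C) :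
    W ⊗[R] (F.obj M).carrier →ₗ[R] (F.obj (tensorRight W M)).carrier :=
  TensorProduct.lift
    (RightComod.linₗ _ _ ∘ₗ F.mapLinearMap R ∘ₗ insertion W M)

end Lambda

theorem lTensor_subtype_injective {R C : Type u} [CommRing R] [AddCommGroup C] [Module R C]
    [Module.Flat R C] {M : Type u} [AddCommGroup M] [Module R M] (K : Submodule R M) :
    Function.Injective (K.subtype.lTensor C) :=
  Module.Flat.lTensor_preserves_injective_linearMap _ K.injective_subtype

section Cotensor

variable {R C D : Type u} [CommRing R] [AddCommGroup C] [Module R C] [Coalgebra R C]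
  [AddCommGroup D] [Module R D] [Coalgebra R D]

/-- A left `C`-coaction and a right `D`-coaction on `M` are compatible if
the left coaction `M → C ⊗ M` is right `D`-colinear, where `C ⊗ M` has the right
coaction `id_C ⊗ ρ_M`. -/
def Compatible {M : Type u} [AddCommGroup M] [Module R M] (l : LeftCoaction R C M)
    (r : RightCoaction R D M) : Prop :=
  ((TensorProduct.assoc R C M D).symm.toLinearMap ∘ₗ r.map.lTensor C) ∘ₗ l.map =
    l.map.rTensor D ∘ₗ r.map

variable (R C D) in
/-- `C`-`D`-bicomodules. -/
structure Bicomod where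
  /-- the underlying right `D`-comodule -/
  right : RightComod R D
  /-- the left `C`-coaction -/
  left : LeftCoaction R C right.carrier
  compatible : Compatible left right.coaction

/-- The map `ρ_X ⊗ id - id ⊗ ρ_P : X ⊗ P → X ⊗ D ⊗ P`. -/
def cotensorMap (X : RightComod R D) (P : LeftComod R D) :
    X.carrier ⊗[R] P.carrier →ₗ[R] X.carrier ⊗[R] (D ⊗[R] P.carrier) :=
  (TensorProduct.assoc R X.carrier D P.carrier).toLinearMap ∘ₗ
    X.coaction.map.rTensor P.carrier - P.coaction.map.lTensor X.carrier

/-- The cotensor product `X □_D P`, as a submodule of `X ⊗ P`. -/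
abbrev cotensor (X : RightComod R D) (P : LeftComod R D) :
    Submodule R (X.carrier ⊗[R] P.carrier) :=
  LinearMap.ker (cotensorMap X P)

/-- `X ⊗ V` for a left coaction on `X` and an `R`-module `V`, with the coaction
`ρ_X ⊗ id_V`. -/
def LeftCoaction.tensor {X : Type u} [AddCommGroup X] [Module R X] (l : LeftCoaction R C X)
    (V : Type u) [AddCommGroup V] [Module R V] : LeftCoaction R C (X ⊗[R] V) where
  map := (TensorProduct.assoc R C X V).toLinearMap ∘ₗ l.map.rTensor V
  coassoc := by
    ext x v
    have h := LinearMap.congr_fun l.coassoc x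
    simp only [LinearMap.comp_apply, LinearEquiv.coe_coe] at h
    have h1 : ∀ t : C ⊗[R] X,
        ((TensorProduct.assoc R C X V).toLinearMap ∘ₗ l.map.rTensor V).lTensor C
          (TensorProduct.assoc R C X V (t ⊗ₜ v)) =
        (TensorProduct.assoc R C (C ⊗[R] X) V (l.map.lTensor C t ⊗ₜ v) |>
          (TensorProduct.assoc R C X V).toLinearMap.lTensor C) := by
      intro t
      induction t with
      | zero => simp
      | add a b ha hb => simp only [TensorProduct.add_tmul, map_add, ha, hb]
      | tmul c x' => simp
    have h2 : ∀ t : C ⊗[R] X,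
        TensorProduct.assoc R C C (X ⊗[R] V)
          ((Coalgebra.comul (R := R) (A := C)).rTensor (X ⊗[R] V)
            (TensorProduct.assoc R C X V (t ⊗ₜ v))) =
        (TensorProduct.assoc R C (C ⊗[R] X) V
          (TensorProduct.assoc R C C X
            ((Coalgebra.comul (R := R) (A := C)).rTensor X t) ⊗ₜ v) |>
          (TensorProduct.assoc R C X V).toLinearMap.lTensor C) := by
      intro t
      induction t with
      | zero => simp
      | add a b ha hb => simp only [TensorProduct.add_tmul, map_add, ha, hb]
      | tmul c x' =>
        simp only [TensorProduct.assoc_tmul, LinearMap.rTensor_tmul]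
        generalize Coalgebra.comul (R := R) c = s
        induction s with
        | zero => simp
        | add a b ha hb => simp only [TensorProduct.add_tmul, map_add, ha, hb]
        | tmul c1 c2 => simp
    simp only [TensorProduct.AlgebraTensorModule.curry_apply, TensorProduct.curry_apply,
      LinearMap.coe_restrictScalars, LinearMap.comp_apply, LinearEquiv.coe_coe,
      LinearMap.rTensor_tmul]
    rw [h1, h2, h]
  counit := by
    ext x v
    have h := LinearMap.congr_fun l.counit x
    simp only [LinearMap.comp_apply, LinearEquiv.coe_coe, LinearMap.id_apply] at h
    have h1 : ∀ t : C ⊗[R] X,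
        TensorProduct.lid R (X ⊗[R] V)
          ((Coalgebra.counit (R := R) (A := C)).rTensor (X ⊗[R] V)
            (TensorProduct.assoc R C X V (t ⊗ₜ v))) =
        TensorProduct.lid R X
          ((Coalgebra.counit (R := R) (A := C)).rTensor X t) ⊗ₜ v := by
      intro t
      induction t with
      | zero => simp
      | add a b ha hb => simp only [TensorProduct.add_tmul, map_add, ha, hb]
      | tmul c x' => simp [TensorProduct.smul_tmul']
    simp only [TensorProduct.AlgebraTensorModule.curry_apply, TensorProduct.curry_apply,
      LinearMap.coe_restrictScalars, LinearMap.comp_apply, LinearEquiv.coe_coe,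
      LinearMap.rTensor_tmul, LinearMap.id_apply]
    rw [h1, h]

/-- Auxiliary: if `C` is flat, an element of the kernel of a left colinear map `f : M → N` has
its coaction in the image of `C ⊗ ker f`. -/
theorem coaction_mem_range [Module.Flat R C] {M N : Type u} [AddCommGroup M] [Module R M]
    [AddCommGroup N] [Module R N] (lM : LeftCoaction R C M) (lN : LeftCoaction R C N)
    (f : M →ₗ[R] N) (hf : lN.map ∘ₗ f = f.lTensor C ∘ₗ lM.map) (z : LinearMap.ker f) :
    lM.map z ∈ LinearMap.range ((LinearMap.ker f).subtype.lTensor C) := by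
  have hex := Module.Flat.lTensor_exact C (f := (LinearMap.ker f).subtype) (g := f)
    (LinearMap.exact_subtype_ker_map f)
  refine (hex _).1 ?_
  have h := LinearMap.congr_fun hf z
  simp only [LinearMap.comp_apply] at h
  rw [← h, LinearMap.mem_ker.1 z.2, map_zero]

/-- The structure map `ker f → C ⊗ ker f` obtained by restricting the coaction of `M`, for `f`
left `C`-colinear and `C` flat. -/
noncomputable def kerMap [Module.Flat R C] {M N : Type u} [AddCommGroup M] [Module R M]
    [AddCommGroup N] [Module R N] (lM : LeftCoaction R C M) (lN : LeftCoaction R C N)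
    (f : M →ₗ[R] N) (hf : lN.map ∘ₗ f = f.lTensor C ∘ₗ lM.map) :
    LinearMap.ker f →ₗ[R] C ⊗[R] LinearMap.ker f :=
  (LinearEquiv.ofInjective _ (lTensor_subtype_injective (C := C)
      (LinearMap.ker f))).symm.toLinearMap ∘ₗ
    (lM.map ∘ₗ (LinearMap.ker f).subtype).codRestrict _ (coaction_mem_range lM lN f hf)

theorem lTensor_comp_kerMap [Module.Flat R C] {M N : Type u} [AddCommGroup M] [Module R M]
    [AddCommGroup N] [Module R N] (lM : LeftCoaction R C M) (lN : LeftCoaction R C N)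
    (f : M →ₗ[R] N) (hf : lN.map ∘ₗ f = f.lTensor C ∘ₗ lM.map) :
    (LinearMap.ker f).subtype.lTensor C ∘ₗ kerMap lM lN f hf =
      lM.map ∘ₗ (LinearMap.ker f).subtype := by
  ext z
  exact congrArg Subtype.val (LinearEquiv.apply_symm_apply
    (LinearEquiv.ofInjective _ (lTensor_subtype_injective (C := C) (LinearMap.ker f)))
    ((lM.map ∘ₗ (LinearMap.ker f).subtype).codRestrict _ (coaction_mem_range lM lN f hf) z))

/-- The kernel of a left colinear map, as a left comodule, for `C` flat: the coaction is the one
for which the inclusion `ker f → M` is colinear. -/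
noncomputable def kerCoaction [Module.Flat R C] {M N : Type u} [AddCommGroup M] [Module R M]
    [AddCommGroup N] [Module R N] (lM : LeftCoaction R C M) (lN : LeftCoaction R C N)
    (f : M →ₗ[R] N) (hf : lN.map ∘ₗ f = f.lTensor C ∘ₗ lM.map) :
    LeftCoaction R C (LinearMap.ker f) where
  map := kerMap lM lN f hf
  coassoc := by
    have key := lTensor_comp_kerMap lM lN f hf
    set ι := (LinearMap.ker f).subtype with hι
    set κ := kerMap lM lN f hf
    have hinj : Function.Injective ((ι.lTensor C).lTensor C) :=
      Module.Flat.lTensor_preserves_injective_linearMap _ (lTensor_subtype_injective _)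
    rw [← LinearMap.cancel_left hinj]
    have h1 : (ι.lTensor C).lTensor C ∘ₗ (κ.lTensor C ∘ₗ κ) =
        lM.map.lTensor C ∘ₗ lM.map ∘ₗ ι := by
      rw [← LinearMap.comp_assoc, ← LinearMap.lTensor_comp, key, LinearMap.lTensor_comp,
        LinearMap.comp_assoc, key]
    have h2 : (ι.lTensor C).lTensor C ∘ₗ (TensorProduct.assoc R C C _).toLinearMap ∘ₗ
        (Coalgebra.comul (R := R) (A := C)).rTensor _ =
        (TensorProduct.assoc R C C M).toLinearMap ∘ₗ
        (Coalgebra.comul (R := R) (A := C)).rTensor M ∘ₗ ι.lTensor C := by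
      ext c z
      simp only [TensorProduct.AlgebraTensorModule.curry_apply, TensorProduct.curry_apply,
        LinearMap.coe_restrictScalars, LinearMap.comp_apply, LinearEquiv.coe_coe,
        LinearMap.rTensor_tmul, LinearMap.lTensor_tmul]
      generalize Coalgebra.comul (R := R) c = s
      induction s with
      | zero => simp
      | add a b ha hb => simp only [TensorProduct.add_tmul, map_add, ha, hb]
      | tmul c1 c2 => simp
    rw [h1, ← LinearMap.comp_assoc, lM.coassoc]
    have h3 := congrArg (fun g => g ∘ₗ κ) h2
    simp only [LinearMap.comp_assoc] at h3 ⊢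
    rw [h3, key]
  counit := by
    have key := lTensor_comp_kerMap lM lN f hf
    set ι := (LinearMap.ker f).subtype with hι
    set κ := kerMap lM lN f hf
    rw [← LinearMap.cancel_left (LinearMap.ker f).injective_subtype, ← hι]
    have h2 : ι ∘ₗ (TensorProduct.lid R _).toLinearMap ∘ₗ
        (Coalgebra.counit (R := R) (A := C)).rTensor _ =
        (TensorProduct.lid R M).toLinearMap ∘ₗ
        (Coalgebra.counit (R := R) (A := C)).rTensor M ∘ₗ ι.lTensor C := by
      ext c z
      simp
    have h3 := congrArg (fun g => g ∘ₗ κ) h2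
    have h4 := congrArg (fun g => g ∘ₗ ι) lM.counit
    simp only [LinearMap.comp_assoc] at h3 h4 ⊢
    rw [h3, key, h4]
    rfl

/-- `ρ_X ⊗ id - id ⊗ ρ_P` is left `C`-colinear for a `C`-`D`-bicomodule `X`. -/
theorem cotensorMap_colinear (X : Bicomod R C D) (P : LeftComod R D) :
    (X.left.tensor (D ⊗[R] P.carrier)).map ∘ₗ cotensorMap X.right P =
      (cotensorMap X.right P).lTensor C ∘ₗ (X.left.tensor P.carrier).map := by
  have h1 : (X.left.tensor (D ⊗[R] P.carrier)).map ∘ₗ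
      P.coaction.map.lTensor X.right.carrier =
      (P.coaction.map.lTensor X.right.carrier).lTensor C ∘ₗ
        (X.left.tensor P.carrier).map := by
    ext x p
    simp only [LeftCoaction.tensor, TensorProduct.AlgebraTensorModule.curry_apply,
      TensorProduct.curry_apply,
      LinearMap.coe_restrictScalars, LinearMap.comp_apply, LinearEquiv.coe_coe,
      LinearMap.rTensor_tmul, LinearMap.lTensor_tmul]
    generalize X.left.map x = s
    induction s with
    | zero => simp
    | add a b ha hb => simp only [TensorProduct.add_tmul, map_add, ha, hb]
    | tmul c1 c2 => simp
  have h2 : (X.left.tensor (D ⊗[R] P.carrier)).map ∘ₗ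
      ((TensorProduct.assoc R X.right.carrier D P.carrier).toLinearMap ∘ₗ
        X.right.coaction.map.rTensor P.carrier) =
      ((TensorProduct.assoc R X.right.carrier D P.carrier).toLinearMap ∘ₗ
        X.right.coaction.map.rTensor P.carrier).lTensor C ∘ₗ
        (X.left.tensor P.carrier).map := by
    ext x p
    have h := LinearMap.congr_fun X.compatible x
    simp only [LinearMap.comp_apply, LinearEquiv.coe_coe] at h
    have ha : ∀ t : X.right.carrier ⊗[R] D,
        (X.left.tensor (D ⊗[R] P.carrier)).map
          (TensorProduct.assoc R X.right.carrier D P.carrier (t ⊗ₜ p)) =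
        ((TensorProduct.assoc R X.right.carrier D P.carrier).toLinearMap.lTensor C ∘ₗ
          (TensorProduct.assoc R C (X.right.carrier ⊗[R] D) P.carrier).toLinearMap ∘ₗ
          (TensorProduct.assoc R C X.right.carrier D).toLinearMap.rTensor P.carrier)
          (X.left.map.rTensor D t ⊗ₜ p) := by
      intro t
      induction t with
      | zero => simp
      | add a b ha hb => simp only [TensorProduct.add_tmul, map_add, ha, hb]
      | tmul x' d =>
        simp only [LeftCoaction.tensor, LinearMap.comp_apply, LinearEquiv.coe_coe,
          LinearMap.rTensor_tmul, TensorProduct.assoc_tmul]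
        generalize X.left.map x' = s
        induction s with
        | zero => simp
        | add a b ha hb => simp only [TensorProduct.add_tmul, map_add, ha, hb]
        | tmul c1 c2 => simp
    have hb : ∀ t : C ⊗[R] X.right.carrier,
        ((TensorProduct.assoc R X.right.carrier D P.carrier).toLinearMap ∘ₗ
          X.right.coaction.map.rTensor P.carrier).lTensor C
          (TensorProduct.assoc R C X.right.carrier P.carrier (t ⊗ₜ p)) =
        ((TensorProduct.assoc R X.right.carrier D P.carrier).toLinearMap.lTensor C ∘ₗ
          (TensorProduct.assoc R C (X.right.carrier ⊗[R] D) P.carrier).toLinearMap ∘ₗ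
          (TensorProduct.assoc R C X.right.carrier D).toLinearMap.rTensor P.carrier)
          ((TensorProduct.assoc R C X.right.carrier D).symm
            (X.right.coaction.map.lTensor C t) ⊗ₜ p) := by
      intro t
      induction t with
      | zero => simp
      | add a b ha hb => simp only [TensorProduct.add_tmul, map_add, ha, hb]
      | tmul c x' => simp
    simp only [TensorProduct.AlgebraTensorModule.curry_apply,
      TensorProduct.curry_apply,
      LinearMap.coe_restrictScalars, LinearMap.comp_apply, LinearEquiv.coe_coe,
      LinearMap.rTensor_tmul]
    rw [ha, ← h, ← hb]
    simp [LeftCoaction.tensor]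
  rw [cotensorMap, LinearMap.comp_sub, h1, h2, LinearMap.lTensor_sub, LinearMap.sub_comp]

/-- `X □_D P` as a left `C`-comodule, for `X` a `C`-`D`-bicomodule, `P` a left `D`-comodule and
`C` flat over `R`; the coaction is the restriction of `ρ_X ⊗ id_P`. -/
noncomputable abbrev cotensorObj [Module.Flat R C] (X : Bicomod R C D) (P : LeftComod R D) :
    LeftComod R C where
  carrier := cotensor X.right P
  coaction := kerCoaction (X.left.tensor P.carrier) (X.left.tensor (D ⊗[R] P.carrier))
    (cotensorMap X.right P) (cotensorMap_colinear X P)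

theorem cotensorMap_natural (X : RightComod R D) {P Q : LeftComod R D} (f : P ⟶ Q) :
    cotensorMap X Q ∘ₗ (LeftComod.lin f).lTensor X.carrier =
      ((LeftComod.lin f).lTensor D).lTensor X.carrier ∘ₗ cotensorMap X P := by
  have hf : Q.coaction.map ∘ₗ LeftComod.lin f =
    (LeftComod.lin f).lTensor D ∘ₗ P.coaction.map := f.2
  rw [cotensorMap, cotensorMap, LinearMap.sub_comp, LinearMap.comp_sub,
    ← LinearMap.lTensor_comp, hf, LinearMap.lTensor_comp]
  congr 1
  ext x p
  simp only [TensorProduct.AlgebraTensorModule.curry_apply, TensorProduct.curry_apply,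
    LinearMap.coe_restrictScalars, LinearMap.comp_apply, LinearEquiv.coe_coe,
    LinearMap.rTensor_tmul, LinearMap.lTensor_tmul]
  generalize X.coaction.map x = s
  induction s with
  | zero => simp
  | add a b ha hb => simp only [TensorProduct.add_tmul, map_add, ha, hb]
  | tmul c1 c2 => simp

/-- The map `id_X □ f : X □_D P → X □_D Q`, the restriction of `id_X ⊗ f`. -/
def cotensorLin (X : RightComod R D) {P Q : LeftComod R D} (f : P ⟶ Q) :
    cotensor X P →ₗ[R] cotensor X Q :=
  ((LeftComod.lin f).lTensor X.carrier).restrict (by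
    intro z hz
    have h := LinearMap.congr_fun (cotensorMap_natural X f) z
    simp only [LinearMap.comp_apply] at h
    change cotensorMap X Q _ = 0
    have hz' : cotensorMap X P z = 0 := hz
    rw [h, hz', map_zero])

theorem cotensorLin_colinear [Module.Flat R C] (X : Bicomod R C D) {P Q : LeftComod R D}
    (f : P ⟶ Q) :
    cotensorLin X.right f ∈ LeftComod.colinear (cotensorObj X P) (cotensorObj X Q) := by
  change (cotensorObj X Q).coaction.map ∘ₗ cotensorLin X.right f =
    (cotensorLin X.right f).lTensor C ∘ₗ (cotensorObj X P).coaction.map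
  have hP : (cotensor X.right P).subtype.lTensor C ∘ₗ (cotensorObj X P).coaction.map =
      (X.left.tensor P.carrier).map ∘ₗ (cotensor X.right P).subtype :=
    lTensor_comp_kerMap _ _ _ (cotensorMap_colinear X P)
  have hQ : (cotensor X.right Q).subtype.lTensor C ∘ₗ (cotensorObj X Q).coaction.map =
      (X.left.tensor Q.carrier).map ∘ₗ (cotensor X.right Q).subtype :=
    lTensor_comp_kerMap _ _ _ (cotensorMap_colinear X Q)
  have hι : (cotensor X.right Q).subtype ∘ₗ cotensorLin X.right f =
      (LeftComod.lin f).lTensor X.right.carrier ∘ₗ (cotensor X.right P).subtype := rfl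
  have hn : (X.left.tensor Q.carrier).map ∘ₗ (LeftComod.lin f).lTensor X.right.carrier =
      ((LeftComod.lin f).lTensor X.right.carrier).lTensor C ∘ₗ
        (X.left.tensor P.carrier).map := by
    ext x p
    simp only [LeftCoaction.tensor, TensorProduct.AlgebraTensorModule.curry_apply,
      TensorProduct.curry_apply,
      LinearMap.coe_restrictScalars, LinearMap.comp_apply, LinearEquiv.coe_coe,
      LinearMap.rTensor_tmul, LinearMap.lTensor_tmul]
    generalize X.left.map x = s
    induction s with
    | zero => simp
    | add a b ha hb => simp only [TensorProduct.add_tmul, map_add, ha, hb]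
    | tmul c1 c2 => simp
  have hinj := lTensor_subtype_injective (C := C) (cotensor X.right Q)
  refine (LinearMap.cancel_left hinj).1 ?_
  have e1 : (cotensor X.right Q).subtype.lTensor C ∘ₗ
      ((cotensorObj X Q).coaction.map ∘ₗ cotensorLin X.right f) =
      (X.left.tensor Q.carrier).map ∘ₗ ((cotensor X.right Q).subtype ∘ₗ
        cotensorLin X.right f) :=
    congrArg (fun g => g ∘ₗ cotensorLin X.right f) hQ
  have e2 : (cotensor X.right Q).subtype.lTensor C ∘ₗ
      ((cotensorLin X.right f).lTensor C ∘ₗ (cotensorObj X P).coaction.map) =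
      ((cotensor X.right Q).subtype ∘ₗ cotensorLin X.right f).lTensor C ∘ₗ
        (cotensorObj X P).coaction.map := by
    rw [LinearMap.lTensor_comp]
    rfl
  refine e1.trans (Eq.trans ?_ e2.symm)
  rw [hι, LinearMap.lTensor_comp, LinearMap.comp_assoc, hP, ← LinearMap.comp_assoc, hn]
  rfl

/-- The cotensor functor `X □_D - : ^D M ⥤ ^C M` of a `C`-`D`-bicomodule `X`, for `C` flat. -/
noncomputable def cotensorFunctor [Module.Flat R C] (X : Bicomod R C D) :
    LeftComod R D ⥤ LeftComod R C where
  obj P := cotensorObj X P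
  map f := ⟨cotensorLin X.right f, cotensorLin_colinear X f⟩
  map_id P := by
    refine Subtype.ext (LinearMap.ext fun z => Subtype.ext ?_)
    exact LinearMap.congr_fun (LinearMap.lTensor_id X.right.carrier P.carrier) z.1
  map_comp f g := by
    refine Subtype.ext (LinearMap.ext fun z => Subtype.ext ?_)
    exact LinearMap.congr_fun
      (LinearMap.lTensor_comp X.right.carrier (LeftComod.lin g) (LeftComod.lin f)) z.1

end Cotensor

end MoritaTakeuchi

/-!
For a comodule `M` and an `R`-module `W`, colinear maps `W ⊗ M → N` are the same as `R`-linear maps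
`W → Hom(M, N)`: the comodule `W ⊗ M` is a copower of `M`, and linear equivalences preserve
copowers. So `λ : W ⊗ F(M) → F(W ⊗ M)` is an isomorphism for every `W` and `M`.

A right `D`-comodule `V` is the kernel of `V ⊗ D → V ⊗ D ⊗ D`. Applying `G` and `λ` gives
`G(V) ≅ V □ G(D)`. For `V = W ⊗ F(C)`, where `G(V) ≅ W ⊗ C`, this says that `C ≅ F(C) □ G(D)`, and
that this kernel is preserved by `W ⊗ -`. Now let `N` be a left `C`-comodule, that is `N ≅ C □ N`.
Inside `F(C) ⊗ G(D) ⊗ N`, both `N` and `F(C) □ (G(D) □ N)` are the intersection of the kernels of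
the two cotensor maps, the latter because `F(C)` is flat; hence `N ≅ F(C) □ (G(D) □ N)`.
-/

namespace MoritaTakeuchi

section RightComodules

variable {R C : Type u} [CommRing R] [AddCommGroup C] [Module R C] [Coalgebra R C]

namespace RightComod

theorem hom_ext {M N : RightComod R C} {f g : M ⟶ N} (h : lin f = lin g) : f = g :=
  Subtype.ext h

theorem lin_colinear {M N : RightComod R C} (f : M ⟶ N) :
    N.coaction.map ∘ₗ lin f = (lin f).rTensor C ∘ₗ M.coaction.map := f.2

theorem bijective_of_isIso {M N : RightComod R C} (f : M ⟶ N) [IsIso f] :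
    Function.Bijective (lin f) :=
  Function.bijective_iff_has_inverse.2 ⟨lin (inv f),
    LinearMap.congr_fun (congrArg lin (IsIso.hom_inv_id f)),
    LinearMap.congr_fun (congrArg lin (IsIso.inv_hom_id f))⟩

theorem isIso_of_bijective {M N : RightComod R C} (f : M ⟶ N)
    (hf : Function.Bijective (lin f)) : IsIso f := by
  let e := LinearEquiv.ofBijective (lin f) hf
  have he : e.symm.toLinearMap ∘ₗ lin f = LinearMap.id := e.symm_comp
  have colinear : M.coaction.map ∘ₗ e.symm.toLinearMap =
      e.symm.toLinearMap.rTensor C ∘ₗ N.coaction.map := by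
    rw [← LinearMap.cancel_right hf.2, LinearMap.comp_assoc, LinearMap.comp_assoc, he,
      lin_colinear, ← LinearMap.comp_assoc, ← LinearMap.rTensor_comp, he, LinearMap.rTensor_id]
    rfl
  exact ⟨⟨e.symm.toLinearMap, colinear⟩, hom_ext he, hom_ext e.comp_symm⟩

theorem mono_of_injective {M N : RightComod R C} (f : M ⟶ N)
    (hf : Function.Injective (lin f)) : Mono f :=
  ⟨fun _ _ h ↦ hom_ext ((LinearMap.cancel_left hf).1 (congrArg lin h))⟩

/-- The underlying linear equivalence of an invertible colinear map. -/
noncomputable def linEquiv {M N : RightComod R C} (f : M ⟶ N) [IsIso f] :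
    M.carrier ≃ₗ[R] N.carrier :=
  LinearEquiv.ofBijective (lin f) (bijective_of_isIso f)

theorem exact_iff_of_iso {M N P M' N' P' : RightComod R C} {f : M ⟶ N} {g : N ⟶ P}
    {f' : M' ⟶ N'} {g' : N' ⟶ P'} (a : M ⟶ M') (b : N ⟶ N') (c : P ⟶ P')
    [IsIso a] [IsIso b] [IsIso c] (hf : a ≫ f' = f ≫ b) (hg : b ≫ g' = g ≫ c) :
    Function.Exact (lin f') (lin g') ↔ Function.Exact (lin f) (lin g) :=
  Function.Exact.iff_of_ladder_linearEquiv (e₁ := linEquiv a) (e₂ := linEquiv b)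
    (e₃ := linEquiv c) (congrArg lin hf) (congrArg lin hg)

end RightComod

section Kernels

variable [Module.Flat R C]

/-- The coaction `κ` on `K` making an injection `ι : K → M` into a comodule colinear. -/
def RightCoaction.restrict {K M : Type u} [AddCommGroup K] [Module R K]
    [AddCommGroup M] [Module R M] (ρ : RightCoaction R C M) (ι : K →ₗ[R] M)
    (hι : Function.Injective ι) (κ : K →ₗ[R] K ⊗[R] C) (hκ : ι.rTensor C ∘ₗ κ = ρ.map ∘ₗ ι) :
    RightCoaction R C K where
  map := κ
  coassoc := by
    rw [← LinearMap.cancel_left (Module.Flat.rTensor_preserves_injective_linearMap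
      (M := C ⊗[R] C) ι hι)]
    calc ι.rTensor (C ⊗[R] C) ∘ₗ (TensorProduct.assoc R K C C).toLinearMap ∘ₗ κ.rTensor C ∘ₗ κ
        = (TensorProduct.assoc R M C C).toLinearMap ∘ₗ (ι.rTensor C ∘ₗ κ).rTensor C ∘ₗ κ := by
          simp only [coassoc_simps]
      _ = (TensorProduct.assoc R M C C).toLinearMap ∘ₗ ρ.map.rTensor C ∘ₗ ι.rTensor C ∘ₗ κ := by
          simp only [hκ, LinearMap.rTensor_comp, LinearMap.comp_assoc]
      _ = ((TensorProduct.assoc R M C C).toLinearMap ∘ₗ ρ.map.rTensor C ∘ₗ ρ.map) ∘ₗ ι := by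
          simp only [hκ, LinearMap.comp_assoc]
      _ = Coalgebra.comul.lTensor M ∘ₗ ι.rTensor C ∘ₗ κ := by
          rw [ρ.coassoc, hκ, LinearMap.comp_assoc]
      _ = ι.rTensor (C ⊗[R] C) ∘ₗ Coalgebra.comul.lTensor K ∘ₗ κ := by
          simp only [coassoc_simps]
  counit := by
    rw [← LinearMap.cancel_left hι]
    calc ι ∘ₗ (TensorProduct.rid R K).toLinearMap ∘ₗ Coalgebra.counit.lTensor K ∘ₗ κ
        = (TensorProduct.rid R M).toLinearMap ∘ₗ Coalgebra.counit.lTensor M ∘ₗ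
            ι.rTensor C ∘ₗ κ := by
          simp only [coassoc_simps]
      _ = ((TensorProduct.rid R M).toLinearMap ∘ₗ Coalgebra.counit.lTensor M ∘ₗ ρ.map) ∘ₗ
            ι := by
          simp only [hκ, LinearMap.comp_assoc]
      _ = ι ∘ₗ LinearMap.id := by rw [ρ.counit, LinearMap.id_comp, LinearMap.comp_id]

namespace RightComod

theorem coaction_ker_mem_range {M N : RightComod R C} (f : M ⟶ N) (x : LinearMap.ker (lin f)) :
    M.coaction.map x ∈ LinearMap.range ((LinearMap.ker (lin f)).subtype.rTensor C) := by
  have exact_rTensor := Module.Flat.rTensor_exact C (LinearMap.exact_subtype_ker_map (lin f))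
  refine (exact_rTensor _).1 ((LinearMap.congr_fun (lin_colinear f) x).symm.trans ?_)
  rw [LinearMap.comp_apply, LinearMap.map_coe_ker, map_zero]

/-- The kernel of a colinear map as a comodule, for a flat coalgebra. -/
noncomputable def ker {M N : RightComod R C} (f : M ⟶ N) : RightComod R C where
  carrier := LinearMap.ker (lin f)
  coaction := M.coaction.restrict (LinearMap.ker (lin f)).subtype
    (LinearMap.ker (lin f)).injective_subtype
    ((M.coaction.map ∘ₗ (LinearMap.ker (lin f)).subtype).codLift _
      (Module.Flat.rTensor_preserves_injective_linearMap _
        (LinearMap.ker (lin f)).injective_subtype) (coaction_ker_mem_range f))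
    (LinearMap.comp_codLift _ _ _ _)

/-- The inclusion of the kernel of a colinear map. -/
noncomputable def kerι {M N : RightComod R C} (f : M ⟶ N) : ker f ⟶ M :=
  ⟨(LinearMap.ker (lin f)).subtype, (LinearMap.comp_codLift (M.coaction.map ∘ₗ _) _
    (Module.Flat.rTensor_preserves_injective_linearMap _
      (LinearMap.ker (lin f)).injective_subtype) (coaction_ker_mem_range f)).symm⟩

theorem kerι_comp {M N : RightComod R C} (f : M ⟶ N) : kerι f ≫ f = 0 :=
  hom_ext (LinearMap.comp_ker_subtype (lin f))

theorem injective_of_mono {M N : RightComod R C} (f : M ⟶ N) [Mono f] :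
    Function.Injective (lin f) := by
  have : kerι f = 0 := by rw [← cancel_mono f, kerι_comp, Limits.zero_comp]
  exact (injective_iff_map_eq_zero _).2 fun x hx ↦
    LinearMap.congr_fun (congrArg lin this : lin (kerι f) = 0) ⟨x, hx⟩

theorem exact_of_isLimit {M N : RightComod R C} {g : M ⟶ N} {c : Limits.KernelFork g}
    (hc : Limits.IsLimit c) : Function.Exact (lin c.ι) (lin g) := by
  refine fun x ↦ ⟨fun hx ↦ ?_, ?_⟩
  · obtain ⟨l, hl⟩ := Limits.KernelFork.IsLimit.lift' hc (kerι g) (kerι_comp g)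
    have hl : lin c.ι ∘ₗ lin l = (LinearMap.ker (lin g)).subtype := congrArg lin hl
    exact ⟨lin l ⟨x, hx⟩, LinearMap.congr_fun hl ⟨x, hx⟩⟩
  · rintro ⟨y, rfl⟩
    exact LinearMap.congr_fun (congrArg lin c.condition) y

/-- The factorization of `k` through an injective colinear map whose image contains that of
`k`. -/
noncomputable def lift {M N Q : RightComod R C} (f : M ⟶ N) (hf : Function.Injective (lin f))
    (k : Q ⟶ N) (hk : ∀ x, lin k x ∈ LinearMap.range (lin f)) : Q ⟶ M :=
  ⟨(lin k).codLift (lin f) hf hk, by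
    have comp_lift : lin f ∘ₗ (lin k).codLift (lin f) hf hk = lin k :=
      LinearMap.comp_codLift _ _ _ _
    change _ ∘ₗ _ = LinearMap.rTensor C _ ∘ₗ _
    rw [← LinearMap.cancel_left (Module.Flat.rTensor_preserves_injective_linearMap
      (M := C) (lin f) hf), ← LinearMap.comp_assoc, ← LinearMap.comp_assoc,
      ← LinearMap.rTensor_comp, comp_lift, ← lin_colinear, ← lin_colinear,
      LinearMap.comp_assoc, comp_lift]⟩

theorem lift_comp {M N Q : RightComod R C} (f : M ⟶ N) (hf : Function.Injective (lin f))
    (k : Q ⟶ N) (hk : ∀ x, lin k x ∈ LinearMap.range (lin f)) : lift f hf k hk ≫ f = k :=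
  hom_ext (LinearMap.comp_codLift _ _ hf hk)

/-- An injective colinear map `f` with image `ker g` is a categorical kernel of `g`. -/
noncomputable def isLimitOfExact {M N P : RightComod R C} (f : M ⟶ N) (g : N ⟶ P)
    (w : f ≫ g = 0) (hf : Function.Injective (lin f)) (hfg : Function.Exact (lin f) (lin g)) :
    Limits.IsLimit (Limits.KernelFork.ofι f w) :=
  have mem_range {Q} (k : Q ⟶ N) (hk : k ≫ g = 0) (x : Q.carrier) :
      lin k x ∈ LinearMap.range (lin f) :=
    (hfg _).1 (LinearMap.congr_fun (congrArg lin hk) x)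
  have : Mono f := mono_of_injective f hf
  Limits.KernelFork.IsLimit.ofι' f w fun {_} k hk ↦
    ⟨lift f hf k (mem_range k hk), lift_comp f hf k (mem_range k hk)⟩

end RightComod

end Kernels

section Equivalences

variable {D : Type u} [AddCommGroup D] [Module R D] [Coalgebra R D] [Module.Flat R D]

namespace RightComod

theorem injective_map (F : RightComod R C ⥤ RightComod R D) [F.IsEquivalence]
    {M N : RightComod R C} (f : M ⟶ N) (hf : Function.Injective (lin f)) :
    Function.Injective (lin (F.map f)) :=
  have : Mono f := mono_of_injective f hf
  injective_of_mono (F.map f)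

theorem exact_map [Module.Flat R C] (F : RightComod R C ⥤ RightComod R D) [F.Additive]
    [F.IsEquivalence] {M N P : RightComod R C} (f : M ⟶ N) (g : N ⟶ P)
    (hf : Function.Injective (lin f)) (hfg : Function.Exact (lin f) (lin g)) :
    Function.Exact (lin (F.map f)) (lin (F.map g)) :=
  have w : f ≫ g = 0 := hom_ext (LinearMap.ext hfg.apply_apply_eq_zero)
  exact_of_isLimit (Limits.KernelFork.mapIsLimit _ (isLimitOfExact f g w hf hfg) F)

end RightComod

end Equivalences

end RightComodules

section Copowers

variable {R C : Type u} [CommRing R] [AddCommGroup C] [Module R C] [Coalgebra R C]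
  {W V : Type u} [AddCommGroup W] [Module R W] [AddCommGroup V] [Module R V]

namespace RightComod

theorem tensorRight_hom_ext {M N : RightComod R C} {f g : tensorRight W M ⟶ N}
    (h : ∀ w, insertion W M w ≫ f = insertion W M w ≫ g) : f = g :=
  hom_ext (TensorProduct.ext' fun w m ↦ LinearMap.congr_fun (congrArg lin (h w)) m)

/-- The universal property of `W ⊗ M` as the copower of `M` by the `R`-module `W`: the colinear
map `w ⊗ m ↦ φ w m`. -/
def tensorRightLift {M N : RightComod R C} (φ : W →ₗ[R] (M ⟶ N)) : tensorRight W M ⟶ N :=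
  ⟨TensorProduct.lift (linₗ M N ∘ₗ φ), by
    refine TensorProduct.ext' fun w m ↦ ?_
    have colinear_w : N.coaction.map (lin (φ w) m) = (lin (φ w)).rTensor C (M.coaction.map m) :=
      LinearMap.congr_fun (lin_colinear (φ w)) m
    have rTensor_insertion : (TensorProduct.lift (linₗ M N ∘ₗ φ)).rTensor C ∘ₗ
        (TensorProduct.assoc R W M.carrier C).symm.toLinearMap ∘ₗ
        TensorProduct.mk R W (M.carrier ⊗[R] C) w = (lin (φ w)).rTensor C :=
      TensorProduct.ext' fun _ _ ↦ rfl
    exact colinear_w.trans (LinearMap.congr_fun rTensor_insertion _).symm⟩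

theorem insertion_tensorRightLift {M N : RightComod R C} (φ : W →ₗ[R] (M ⟶ N)) (w : W) :
    insertion W M w ≫ tensorRightLift φ = φ w := rfl

/-- The colinear map `f ⊗ id : W ⊗ M → V ⊗ M`. -/
def rTensorHom (f : W →ₗ[R] V) (M : RightComod R C) : tensorRight W M ⟶ tensorRight V M :=
  ⟨f.rTensor M.carrier, by
    change (_ ∘ₗ _) ∘ₗ _ = _ ∘ₗ _ ∘ₗ _
    simp only [coassoc_simps]⟩

variable (W) in
/-- The colinear map `id ⊗ g : W ⊗ M → W ⊗ N`. -/
def lTensorHom {M N : RightComod R C} (g : M ⟶ N) : tensorRight W M ⟶ tensorRight W N :=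
  ⟨(lin g).lTensor W, by
    change (_ ∘ₗ N.coaction.map.lTensor W) ∘ₗ _ = _
    rw [LinearMap.comp_assoc, ← LinearMap.lTensor_comp, lin_colinear, LinearMap.lTensor_comp]
    change _ = _ ∘ₗ _ ∘ₗ _
    simp only [coassoc_simps]⟩

variable (W V) in
/-- The associator `(W ⊗ V) ⊗ M → W ⊗ (V ⊗ M)` as a colinear map. -/
def assocHom (M : RightComod R C) :
    tensorRight (W ⊗[R] V) M ⟶ tensorRight W (tensorRight V M) :=
  ⟨(TensorProduct.assoc R W V M.carrier).toLinearMap, by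
    refine TensorProduct.ext_threefold fun w v m ↦ ?_
    change (TensorProduct.assoc R W (V ⊗[R] M.carrier) C).symm
        (w ⊗ₜ (TensorProduct.assoc R V M.carrier C).symm (v ⊗ₜ M.coaction.map m)) =
      (TensorProduct.assoc R W V M.carrier).toLinearMap.rTensor C
        ((TensorProduct.assoc R (W ⊗[R] V) M.carrier C).symm ((w ⊗ₜ v) ⊗ₜ M.coaction.map m))
    induction M.coaction.map m with
    | zero => simp only [TensorProduct.tmul_zero, map_zero]
    | add s t hs ht => simp only [TensorProduct.tmul_add, map_add, hs, ht]
    | tmul _ _ => rfl⟩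

/-- The canonical isomorphism `R ⊗ M → M` as a colinear map. -/
def lidHom (M : RightComod R C) : tensorRight R M ⟶ M :=
  ⟨(TensorProduct.lid R M.carrier).toLinearMap, by
    refine TensorProduct.ext' fun r m ↦ ?_
    change M.coaction.map (TensorProduct.lid R M.carrier (r ⊗ₜ m)) =
      (TensorProduct.lid R M.carrier).toLinearMap.rTensor C
        ((TensorProduct.assoc R R M.carrier C).symm (r ⊗ₜ M.coaction.map m))
    rw [TensorProduct.lid_tmul, map_smul]
    induction M.coaction.map m with
    | zero => simp only [TensorProduct.tmul_zero, map_zero, smul_zero]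
    | add s t hs ht => simp only [TensorProduct.tmul_add, map_add, smul_add, hs, ht]
    | tmul _ _ => rfl⟩

instance {M N : RightComod R C} (g : M ⟶ N) [IsIso g] : IsIso (lTensorHom W g) :=
  isIso_of_bijective _ ((linEquiv g).lTensor W).bijective

instance (M : RightComod R C) : IsIso (assocHom W V M) :=
  isIso_of_bijective _ (TensorProduct.assoc R W V M.carrier).bijective

theorem lTensorHom_comp {M N P : RightComod R C} (f : M ⟶ N) (g : N ⟶ P) :
    lTensorHom W (f ≫ g) = lTensorHom W f ≫ lTensorHom W g :=
  hom_ext (LinearMap.lTensor_comp W (lin g) (lin f))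

theorem insertion_rTensorHom (f : W →ₗ[R] V) (M : RightComod R C) (w : W) :
    insertion W M w ≫ rTensorHom f M = insertion V M (f w) := rfl

theorem insertion_lTensorHom {M N : RightComod R C} (g : M ⟶ N) (w : W) :
    insertion W M w ≫ lTensorHom W g = g ≫ insertion W N w := rfl

theorem insertion_tmul_assocHom (M : RightComod R C) (w : W) (v : V) :
    insertion (W ⊗[R] V) M (w ⊗ₜ v) ≫ assocHom W V M =
      insertion V M v ≫ insertion W (tensorRight V M) w := rfl

theorem insertion_lidHom (M : RightComod R C) (r : R) : insertion R M r ≫ lidHom M = r • 𝟙 M :=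
  hom_ext (LinearMap.ext fun m ↦ TensorProduct.lid_tmul m r)

/-- The coaction of `V` as a colinear map `V → V ⊗ C`. -/
def coactionHom (V : RightComod R C) : V ⟶ tensorRight V.carrier (regular R C) :=
  ⟨V.coaction.map, by
    change (_ ∘ₗ _) ∘ₗ _ = _
    rw [LinearMap.comp_assoc, ← V.coaction.coassoc, ← LinearMap.comp_assoc,
      LinearEquiv.symm_comp, LinearMap.id_comp]⟩

theorem coactionHom_natural {V W : RightComod R C} (f : V ⟶ W) :
    f ≫ coactionHom W = coactionHom V ≫ rTensorHom (lin f) (regular R C) :=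
  hom_ext (lin_colinear f)

theorem coactionHom_tensorRight (V : RightComod R C) :
    coactionHom (tensorRight W V) ≫ assocHom W V.carrier (regular R C) =
      lTensorHom W (coactionHom V) :=
  hom_ext (LinearMap.ext fun _ ↦
    (TensorProduct.assoc R W V.carrier C).apply_symm_apply _)

theorem coaction_injective (V : RightComod R C) : Function.Injective V.coaction.map :=
  LinearMap.injective_of_comp_eq_id _
    ((TensorProduct.rid R V.carrier).toLinearMap ∘ₗ Coalgebra.counit.lTensor V.carrier)
    V.coaction.counit

end RightComod

end Copowers

section CanonicalMap

variable {R C D : Type u} [CommRing R] [AddCommGroup C] [Module R C] [Coalgebra R C]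
  [AddCommGroup D] [Module R D] [Coalgebra R D]
  (F : RightComod R C ⥤ RightComod R D) [F.Additive] [F.Linear R]
  {W V : Type u} [AddCommGroup W] [Module R W] [AddCommGroup V] [Module R V]

open RightComod

variable (W) in
/-- The canonical map `lam F W M : W ⊗ F(M) → F(W ⊗ M)` as a colinear map. -/
def lamHom (M : RightComod R C) : tensorRight W (F.obj M) ⟶ F.obj (tensorRight W M) :=
  tensorRightLift (F.mapLinearMap R ∘ₗ insertion W M)

theorem insertion_lamHom (M : RightComod R C) (w : W) :
    insertion W (F.obj M) w ≫ lamHom F W M = F.map (insertion W M w) :=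
  insertion_tensorRightLift _ w

theorem rTensorHom_lamHom (f : W →ₗ[R] V) (M : RightComod R C) :
    rTensorHom f (F.obj M) ≫ lamHom F V M = lamHom F W M ≫ F.map (rTensorHom f M) :=
  tensorRight_hom_ext fun w ↦ by
    rw [reassoc_of% insertion_rTensorHom, reassoc_of% insertion_lamHom, insertion_lamHom,
      ← F.map_comp, insertion_rTensorHom]

theorem lTensorHom_lamHom {M N : RightComod R C} (g : M ⟶ N) :
    lTensorHom W (F.map g) ≫ lamHom F W N = lamHom F W M ≫ F.map (lTensorHom W g) :=
  tensorRight_hom_ext fun w ↦ by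
    rw [reassoc_of% insertion_lTensorHom, reassoc_of% insertion_lamHom, insertion_lamHom,
      ← F.map_comp, ← F.map_comp, insertion_lTensorHom]

theorem lamHom_assocHom (M : RightComod R C) :
    lamHom F (W ⊗[R] V) M ≫ F.map (assocHom W V M) =
      assocHom W V (F.obj M) ≫ lTensorHom W (lamHom F V M) ≫ lamHom F W (tensorRight V M) :=
  hom_ext (TensorProduct.ext_threefold fun w v x ↦ by
    have insertions : insertion (W ⊗[R] V) (F.obj M) (w ⊗ₜ v) ≫ lamHom F (W ⊗[R] V) M ≫
          F.map (assocHom W V M) =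
        insertion (W ⊗[R] V) (F.obj M) (w ⊗ₜ v) ≫ assocHom W V (F.obj M) ≫
          lTensorHom W (lamHom F V M) ≫ lamHom F W (tensorRight V M) := by
      rw [reassoc_of% insertion_lamHom, reassoc_of% insertion_tmul_assocHom,
        reassoc_of% insertion_lTensorHom, reassoc_of% insertion_lamHom, insertion_lamHom,
        ← F.map_comp, ← F.map_comp, insertion_tmul_assocHom]
    exact LinearMap.congr_fun (congrArg lin insertions) x)

theorem lamHom_lidHom (M : RightComod R C) :
    lamHom F R M ≫ F.map (lidHom M) = lidHom (F.obj M) :=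
  tensorRight_hom_ext fun r ↦ by
    rw [reassoc_of% insertion_lamHom, ← F.map_comp, insertion_lidHom, insertion_lidHom,
      F.map_smul, F.map_id]

section Equivalence

variable [F.IsEquivalence]

variable (W) in
theorem lamHom_comp_bijective (M : RightComod R C) (N : RightComod R D) :
    Function.Bijective fun f : F.obj (tensorRight W M) ⟶ N ↦ lamHom F W M ≫ f := by
  let i : F.obj (F.objPreimage N) ≅ N := F.objObjPreimageIso N
  refine ⟨fun f f' h ↦ ?_, fun h ↦ ?_⟩
  · rw [← cancel_mono i.inv]
    obtain ⟨g, hg⟩ := F.map_surjective (f ≫ i.inv)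
    obtain ⟨g', hg'⟩ := F.map_surjective (f' ≫ i.inv)
    rw [← hg, ← hg']
    refine congrArg F.map (tensorRight_hom_ext fun w ↦ F.map_injective ?_)
    rw [F.map_comp, F.map_comp, hg, hg', ← insertion_lamHom]
    simpa using congrArg (fun k ↦ insertion W (F.obj M) w ≫ k ≫ i.inv) h
  · let mapEquiv : (M ⟶ F.objPreimage N) ≃ₗ[R] (F.obj M ⟶ F.obj (F.objPreimage N)) :=
      LinearEquiv.ofBijective (F.mapLinearMap R) ⟨F.map_injective, F.map_surjective⟩
    have map_symm (k) : F.map (mapEquiv.symm k) = k := mapEquiv.apply_symm_apply k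
    let φ : W →ₗ[R] (M ⟶ F.objPreimage N) :=
      mapEquiv.symm.toLinearMap ∘ₗ Linear.rightComp R (F.obj M) (h ≫ i.inv) ∘ₗ
        insertion W (F.obj M)
    have map_φ (w) : F.map (φ w) = insertion W (F.obj M) w ≫ h ≫ i.inv := map_symm _
    refine ⟨F.map (tensorRightLift φ) ≫ i.hom, tensorRight_hom_ext fun w ↦ ?_⟩
    rw [reassoc_of% insertion_lamHom, ← F.map_comp_assoc, insertion_tensorRightLift, map_φ]
    simp only [Category.assoc, Iso.inv_hom_id, Category.comp_id]

instance (M : RightComod R C) : IsIso (lamHom F W M) :=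
  isIso_of_coyoneda_map_bijective _ (lamHom_comp_bijective F W M)

variable (W) in
theorem lam_bijective (M : RightComod R C) : Function.Bijective (lam F W M) :=
  bijective_of_isIso (lamHom F W M)

end Equivalence

end CanonicalMap

section Bicomodules

variable {R B C : Type u} [CommRing R] [AddCommGroup B] [Module R B] [Coalgebra R B]
  [AddCommGroup C] [Module R C] [Coalgebra R C]

open RightComod

/-- The left comodule underlying a bicomodule. -/
abbrev Bicomod.toLeft (X : Bicomod R B C) : LeftComod R B where
  carrier := X.right.carrier
  coaction := X.left

/-- The left coaction of a bicomodule as a morphism of right comodules. -/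
def Bicomod.leftHom (X : Bicomod R B C) : X.right ⟶ tensorRight B X.right :=
  ⟨X.left.map, X.compatible⟩

theorem Bicomod.leftHom_coassoc (X : Bicomod R B C) :
    X.leftHom ≫ lTensorHom B X.leftHom =
      X.leftHom ≫ rTensorHom Coalgebra.comul X.right ≫ assocHom B B X.right :=
  hom_ext X.left.coassoc

theorem Bicomod.leftHom_counit (X : Bicomod R B C) :
    X.leftHom ≫ rTensorHom Coalgebra.counit X.right ≫ lidHom X.right = 𝟙 X.right :=
  hom_ext X.left.counit

/-- The map `ρ_V ⊗ id - id ⊗ ρ_X`, whose kernel is the cotensor product `V □_B X`, as a morphism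
of right comodules. -/
def cotensorHom (V : RightComod R B) (X : Bicomod R B C) :
    tensorRight V.carrier X.right ⟶ tensorRight V.carrier (tensorRight B X.right) :=
  rTensorHom V.coaction.map X.right ≫ assocHom V.carrier B X.right -
    lTensorHom V.carrier X.leftHom

theorem lin_cotensorHom (V : RightComod R B) (X : Bicomod R B C) :
    lin (cotensorHom V X) = cotensorMap V X.toLeft := rfl

variable (R C) in
/-- `C` as a bicomodule over itself. -/
abbrev regularBicomod : Bicomod R C C where
  right := regular R C
  left := { map := Coalgebra.comul, coassoc := Coalgebra.coassoc.symm, counit := by ext; simp }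
  compatible := (comulHom R C).2

theorem cotensorMap_comp_coaction (V : RightComod R C) :
    cotensorMap V (regularBicomod R C).toLeft ∘ₗ V.coaction.map = 0 :=
  (LinearMap.sub_comp _ _ _).trans (sub_eq_zero.2 V.coaction.coassoc)

/-- The contracting homotopy which makes `0 → V → V ⊗ C → V ⊗ C ⊗ C` exact. -/
theorem lTensor_counit_comp_cotensorMap (V : RightComod R C) :
    ((TensorProduct.rid R C).toLinearMap ∘ₗ Coalgebra.counit.lTensor C).lTensor V.carrier ∘ₗ
        cotensorMap V (regularBicomod R C).toLeft =
      V.coaction.map ∘ₗ (TensorProduct.rid R V.carrier).toLinearMap ∘ₗ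
        Coalgebra.counit.lTensor V.carrier - LinearMap.id := by
  have coaction_part :
      ((TensorProduct.rid R C).toLinearMap ∘ₗ Coalgebra.counit.lTensor C).lTensor V.carrier ∘ₗ
          (TensorProduct.assoc R V.carrier C C).toLinearMap ∘ₗ V.coaction.map.rTensor C =
        V.coaction.map ∘ₗ (TensorProduct.rid R V.carrier).toLinearMap ∘ₗ
          Coalgebra.counit.lTensor V.carrier := by
    refine TensorProduct.ext' fun v c ↦ ?_
    simp only [LinearMap.comp_apply, LinearEquiv.coe_coe, LinearMap.rTensor_tmul,
      LinearMap.lTensor_tmul, TensorProduct.rid_tmul, map_smul]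
    induction V.coaction.map v with
    | zero => simp only [TensorProduct.zero_tmul, map_zero, smul_zero]
    | add s t hs ht => simp only [TensorProduct.add_tmul, map_add, smul_add, hs, ht]
    | tmul _ _ => simp
  have comul_part :
      ((TensorProduct.rid R C).toLinearMap ∘ₗ Coalgebra.counit.lTensor C).lTensor V.carrier ∘ₗ
          Coalgebra.comul.lTensor V.carrier = LinearMap.id := by
    rw [← LinearMap.lTensor_comp, LinearMap.comp_assoc, (regular R C).coaction.counit,
      LinearMap.lTensor_id]
  exact (LinearMap.comp_sub _ _ _).trans (congrArg₂ (· - ·) coaction_part comul_part)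

theorem exact_coactionHom (V : RightComod R C) :
    Function.Exact (lin (coactionHom V)) (lin (cotensorHom V (regularBicomod R C))) := by
  refine fun z ↦ ⟨fun hz ↦ ?_, ?_⟩
  · have contract := LinearMap.congr_fun (lTensor_counit_comp_cotensorMap V) z
    rw [LinearMap.comp_apply, ← lin_cotensorHom, hz, map_zero] at contract
    exact ⟨_, sub_eq_zero.1 contract.symm⟩
  · rintro ⟨v, rfl⟩
    exact LinearMap.congr_fun (cotensorMap_comp_coaction V) v

end Bicomodules

section Functoriality

variable {R B C D : Type u} [CommRing R] [AddCommGroup B] [Module R B] [Coalgebra R B]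
  [AddCommGroup C] [Module R C] [Coalgebra R C] [AddCommGroup D] [Module R D] [Coalgebra R D]
  (F : RightComod R C ⥤ RightComod R D) [F.Additive] [F.Linear R] [F.IsEquivalence]

open RightComod

/-- The left coaction `λ⁻¹ ∘ F(ρ)` on the image of a bicomodule under `F`. -/
noncomputable def mapLeftHom (X : Bicomod R B C) :
    F.obj X.right ⟶ tensorRight B (F.obj X.right) :=
  F.map X.leftHom ≫ inv (lamHom F B X.right)

theorem mapLeftHom_lamHom (X : Bicomod R B C) :
    mapLeftHom F X ≫ lamHom F B X.right = F.map X.leftHom := by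
  rw [mapLeftHom, Category.assoc, IsIso.inv_hom_id, Category.comp_id]

theorem mapLeftHom_coassoc (X : Bicomod R B C) :
    mapLeftHom F X ≫ lTensorHom B (mapLeftHom F X) =
      mapLeftHom F X ≫ rTensorHom Coalgebra.comul (F.obj X.right) ≫
        assocHom B B (F.obj X.right) := by
  rw [← cancel_mono (lTensorHom B (lamHom F B X.right)),
    ← cancel_mono (lamHom F B (tensorRight B X.right))]
  calc _ = (mapLeftHom F X ≫ lTensorHom B (F.map X.leftHom)) ≫
          lamHom F B (tensorRight B X.right) := by
        simp only [← mapLeftHom_lamHom, lTensorHom_comp, Category.assoc]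
    _ = F.map (X.leftHom ≫ lTensorHom B X.leftHom) := by
        rw [Category.assoc, lTensorHom_lamHom, reassoc_of% mapLeftHom_lamHom F X, F.map_comp]
    _ = mapLeftHom F X ≫ lamHom F B X.right ≫ F.map (rTensorHom Coalgebra.comul X.right) ≫
          F.map (assocHom B B X.right) := by
        rw [X.leftHom_coassoc, F.map_comp, F.map_comp, reassoc_of% mapLeftHom_lamHom F X]
    _ = _ := by
        rw [← reassoc_of% rTensorHom_lamHom, lamHom_assocHom]
        simp only [Category.assoc]

theorem mapLeftHom_counit (X : Bicomod R B C) :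
    mapLeftHom F X ≫ rTensorHom Coalgebra.counit (F.obj X.right) ≫ lidHom (F.obj X.right) =
      𝟙 (F.obj X.right) := by
  rw [← lamHom_lidHom, reassoc_of% rTensorHom_lamHom, reassoc_of% mapLeftHom_lamHom F X,
    ← F.map_comp, ← F.map_comp, X.leftHom_counit, F.map_id]

/-- The image of a bicomodule under an equivalence of categories of right comodules. -/
noncomputable def mapBicomod (X : Bicomod R B C) : Bicomod R B D where
  right := F.obj X.right
  left :=
    { map := lin (mapLeftHom F X)
      coassoc := congrArg lin (mapLeftHom_coassoc F X)
      counit := congrArg lin (mapLeftHom_counit F X) }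
  compatible := lin_colinear (mapLeftHom F X)

theorem lam_comp_mapBicomod_left (X : Bicomod R B C) :
    lam F B X.right ∘ₗ (mapBicomod F X).left.map = lin (F.map X.leftHom) :=
  congrArg lin (mapLeftHom_lamHom F X)

theorem lamHom_cotensorHom (V : RightComod R B) (X : Bicomod R B C) :
    lamHom F V.carrier X.right ≫ F.map (cotensorHom V X) =
      cotensorHom V (mapBicomod F X) ≫ lTensorHom V.carrier (lamHom F B X.right) ≫
        lamHom F V.carrier (tensorRight B X.right) := by
  have right_coaction : lamHom F V.carrier X.right ≫
        F.map (rTensorHom V.coaction.map X.right ≫ assocHom V.carrier B X.right) =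
      (rTensorHom V.coaction.map (F.obj X.right) ≫ assocHom V.carrier B (F.obj X.right)) ≫
        lTensorHom V.carrier (lamHom F B X.right) ≫
          lamHom F V.carrier (tensorRight B X.right) := by
    rw [F.map_comp, ← reassoc_of% rTensorHom_lamHom, lamHom_assocHom, Category.assoc]
  have left_coaction : lamHom F V.carrier X.right ≫ F.map (lTensorHom V.carrier X.leftHom) =
      lTensorHom V.carrier (mapLeftHom F X) ≫ lTensorHom V.carrier (lamHom F B X.right) ≫
        lamHom F V.carrier (tensorRight B X.right) := by
    rw [← lTensorHom_lamHom, ← mapLeftHom_lamHom, lTensorHom_comp, Category.assoc]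
  rw [cotensorHom, cotensorHom, F.map_sub, Preadditive.comp_sub, Preadditive.sub_comp,
    right_coaction, left_coaction]
  rfl

/-- The morphism `F(V) → V ⊗ F(C)` induced by the coaction of `V`, which identifies `F(V)` with
the cotensor product `V □_C F(C)`. -/
noncomputable def toTensor (V : RightComod R C) :
    F.obj V ⟶ tensorRight V.carrier (F.obj (regular R C)) :=
  F.map (coactionHom V) ≫ inv (lamHom F V.carrier (regular R C))

theorem toTensor_lamHom (V : RightComod R C) :
    toTensor F V ≫ lamHom F V.carrier (regular R C) = F.map (coactionHom V) := by
  rw [toTensor, Category.assoc, IsIso.inv_hom_id, Category.comp_id]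

theorem toTensor_natural {V W : RightComod R C} (f : V ⟶ W) :
    F.map f ≫ toTensor F W = toTensor F V ≫ rTensorHom (lin f) (F.obj (regular R C)) := by
  rw [← cancel_mono (lamHom F W.carrier (regular R C)), Category.assoc, Category.assoc,
    toTensor_lamHom, rTensorHom_lamHom, reassoc_of% toTensor_lamHom, ← F.map_comp, ← F.map_comp,
    coactionHom_natural]

theorem lamHom_toTensor (W : Type u) [AddCommGroup W] [Module R W] (V : RightComod R C) :
    lamHom F W V ≫ toTensor F (tensorRight W V) ≫
        assocHom W V.carrier (F.obj (regular R C)) = lTensorHom W (toTensor F V) := by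
  rw [← cancel_mono (lTensorHom W (lamHom F V.carrier (regular R C))),
    ← cancel_mono (lamHom F W (tensorRight V.carrier (regular R C)))]
  simp only [Category.assoc]
  rw [← lamHom_assocHom, reassoc_of% toTensor_lamHom, ← F.map_comp, coactionHom_tensorRight,
    ← reassoc_of% lTensorHom_comp, toTensor_lamHom, lTensorHom_lamHom]

variable [Module.Flat R D]

theorem toTensor_injective (V : RightComod R C) : Function.Injective (lin (toTensor F V)) :=
  (bijective_of_isIso (inv (lamHom F V.carrier (regular R C)))).injective.comp
    (injective_map F (coactionHom V) (coaction_injective V))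

theorem exact_toTensor [Module.Flat R C] (V : RightComod R C) :
    Function.Exact (lin (toTensor F V))
      (lin (cotensorHom V (mapBicomod F (regularBicomod R C)))) :=
  (exact_iff_of_iso (𝟙 (F.obj V)) (lamHom F V.carrier (regular R C))
    (lTensorHom V.carrier (lamHom F C (regular R C)) ≫
      lamHom F V.carrier (tensorRight C (regular R C)))
    (by rw [Category.id_comp, toTensor_lamHom]) (lamHom_cotensorHom F V (regularBicomod R C))).1
    (exact_map F (coactionHom V) _ (coaction_injective V) (exact_coactionHom V))

end Functoriality

section LeftComodules

variable {R C : Type u} [CommRing R] [AddCommGroup C] [Module R C] [Coalgebra R C]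

namespace LeftComod

theorem hom_ext {M N : LeftComod R C} {f g : M ⟶ N} (h : lin f = lin g) : f = g :=
  Subtype.ext h

theorem lin_colinear {M N : LeftComod R C} (f : M ⟶ N) :
    N.coaction.map ∘ₗ lin f = (lin f).lTensor C ∘ₗ M.coaction.map := f.2

theorem mono_of_injective {M N : LeftComod R C} (f : M ⟶ N)
    (hf : Function.Injective (lin f)) : Mono f :=
  ⟨fun _ _ h ↦ hom_ext ((LinearMap.cancel_left hf).1 (congrArg lin h))⟩

theorem coaction_injective (N : LeftComod R C) : Function.Injective N.coaction.map :=
  LinearMap.injective_of_comp_eq_id _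
    ((TensorProduct.lid R N.carrier).toLinearMap ∘ₗ Coalgebra.counit.rTensor N.carrier)
    N.coaction.counit

theorem cotensorMap_comp_coaction (N : LeftComod R C) :
    cotensorMap (regular R C) N ∘ₗ N.coaction.map = 0 :=
  (LinearMap.sub_comp _ _ _).trans (sub_eq_zero.2 N.coaction.coassoc.symm)

/-- The contracting homotopy which makes `0 → N → C ⊗ N → C ⊗ C ⊗ N` exact. -/
theorem counit_comp_cotensorMap (N : LeftComod R C) :
    (TensorProduct.lid R (C ⊗[R] N.carrier)).toLinearMap ∘ₗ
        Coalgebra.counit.rTensor (C ⊗[R] N.carrier) ∘ₗ cotensorMap (regular R C) N =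
      LinearMap.id - N.coaction.map ∘ₗ (TensorProduct.lid R N.carrier).toLinearMap ∘ₗ
        Coalgebra.counit.rTensor N.carrier := by
  have comul_part : (TensorProduct.lid R (C ⊗[R] N.carrier)).toLinearMap ∘ₗ
      Coalgebra.counit.rTensor (C ⊗[R] N.carrier) ∘ₗ
        (TensorProduct.assoc R C C N.carrier).toLinearMap ∘ₗ
          Coalgebra.comul.rTensor N.carrier = LinearMap.id := by
    have contract : (TensorProduct.lid R (C ⊗[R] N.carrier)).toLinearMap ∘ₗ
        Coalgebra.counit.rTensor (C ⊗[R] N.carrier) ∘ₗ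
          (TensorProduct.assoc R C C N.carrier).toLinearMap =
        ((TensorProduct.lid R C).toLinearMap ∘ₗ Coalgebra.counit.rTensor C).rTensor N.carrier :=
      TensorProduct.ext_threefold fun c c' n ↦ by simp [TensorProduct.smul_tmul']
    have counit_comul : ((TensorProduct.lid R C).toLinearMap ∘ₗ Coalgebra.counit.rTensor C) ∘ₗ
        Coalgebra.comul = LinearMap.id := by
      ext c
      simp
    rw [← LinearMap.comp_assoc, ← LinearMap.comp_assoc,
      LinearMap.comp_assoc _ _ (LinearEquiv.toLinearMap _), contract, ← LinearMap.rTensor_comp,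
      counit_comul, LinearMap.rTensor_id]
  have coaction_part : (TensorProduct.lid R (C ⊗[R] N.carrier)).toLinearMap ∘ₗ
      Coalgebra.counit.rTensor (C ⊗[R] N.carrier) ∘ₗ N.coaction.map.lTensor C =
        N.coaction.map ∘ₗ (TensorProduct.lid R N.carrier).toLinearMap ∘ₗ
          Coalgebra.counit.rTensor N.carrier := by
    simp only [coassoc_simps]
  rw [cotensorMap, LinearMap.comp_sub, LinearMap.comp_sub, comul_part, coaction_part]

theorem exact_coaction (N : LeftComod R C) :
    Function.Exact N.coaction.map (cotensorMap (regular R C) N) := by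
  refine fun z ↦ ⟨fun hz ↦ ?_, ?_⟩
  · have contract := LinearMap.congr_fun (counit_comp_cotensorMap N) z
    rw [LinearMap.comp_apply, LinearMap.comp_apply, hz, map_zero, map_zero] at contract
    exact ⟨_, (sub_eq_zero.1 contract.symm).symm⟩
  · rintro ⟨n, rfl⟩
    exact LinearMap.congr_fun (cotensorMap_comp_coaction N) n

/-- `N ⊗ V` for a left comodule `N` and an `R`-module `V`, with the coaction `ρ_N ⊗ id_V`. -/
abbrev tensor (N : LeftComod R C) (V : Type u) [AddCommGroup V] [Module R V] :
    LeftComod R C where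
  carrier := N.carrier ⊗[R] V
  coaction := N.coaction.tensor V

variable {V W : Type u} [AddCommGroup V] [Module R V] [AddCommGroup W] [Module R W]

variable (V) in
/-- The colinear map `f ⊗ id : M ⊗ V → N ⊗ V`. -/
def rTensorHom {M N : LeftComod R C} (f : M ⟶ N) : M.tensor V ⟶ N.tensor V :=
  ⟨(lin f).rTensor V, by
    change (_ ∘ₗ N.coaction.map.rTensor V) ∘ₗ _ = _
    rw [LinearMap.comp_assoc, ← LinearMap.rTensor_comp, lin_colinear]
    change _ = _ ∘ₗ _ ∘ₗ M.coaction.map.rTensor V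
    simp only [coassoc_simps]⟩

/-- The colinear map `id ⊗ g : N ⊗ V → N ⊗ W`. -/
def lTensorHom (N : LeftComod R C) (g : V →ₗ[R] W) : N.tensor V ⟶ N.tensor W :=
  ⟨g.lTensor N.carrier, by
    change (_ ∘ₗ _) ∘ₗ _ = _ ∘ₗ _ ∘ₗ N.coaction.map.rTensor V
    simp only [coassoc_simps]⟩

variable (V W) in
/-- The associator `(N ⊗ V) ⊗ W → N ⊗ (V ⊗ W)` as a colinear map. -/
def assocHom (N : LeftComod R C) : (N.tensor V).tensor W ⟶ N.tensor (V ⊗[R] W) :=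
  ⟨(TensorProduct.assoc R N.carrier V W).toLinearMap, by
    refine TensorProduct.ext_threefold fun n v w ↦ ?_
    change TensorProduct.assoc R C N.carrier (V ⊗[R] W) (N.coaction.map n ⊗ₜ (v ⊗ₜ w)) =
      (TensorProduct.assoc R N.carrier V W).toLinearMap.lTensor C
        (TensorProduct.assoc R C (N.carrier ⊗[R] V) W
          (TensorProduct.assoc R C N.carrier V (N.coaction.map n ⊗ₜ v) ⊗ₜ w))
    induction N.coaction.map n with
    | zero => simp only [TensorProduct.zero_tmul, map_zero]
    | add s t hs ht => simp only [TensorProduct.add_tmul, map_add, hs, ht]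
    | tmul c n => rfl⟩

/-- The coaction of `N` as a colinear map `N → C ⊗ N`. -/
def coactionHom (N : LeftComod R C) : N ⟶ (regularBicomod R C).toLeft.tensor N.carrier :=
  ⟨N.coaction.map, N.coaction.coassoc.symm⟩

section Lift

variable [Module.Flat R C]

/-- The factorization of `k` through an injective colinear map whose image contains that of
`k`. -/
noncomputable def lift {M N Q : LeftComod R C} (f : M ⟶ N) (hf : Function.Injective (lin f))
    (k : Q ⟶ N) (hk : LinearMap.range (lin k) ≤ LinearMap.range (lin f)) : Q ⟶ M :=
  ⟨(lin k).codLift (lin f) hf fun x ↦ hk ⟨x, rfl⟩, by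
    have comp_lift : lin f ∘ₗ (lin k).codLift (lin f) hf (fun x ↦ hk ⟨x, rfl⟩) = lin k :=
      LinearMap.comp_codLift _ _ _ _
    change _ ∘ₗ _ = LinearMap.lTensor C _ ∘ₗ _
    rw [← LinearMap.cancel_left (Module.Flat.lTensor_preserves_injective_linearMap
      (M := C) (lin f) hf), ← LinearMap.comp_assoc, ← LinearMap.comp_assoc,
      ← LinearMap.lTensor_comp, comp_lift, ← lin_colinear, ← lin_colinear,
      LinearMap.comp_assoc, comp_lift]⟩

theorem lift_comp {M N Q : LeftComod R C} (f : M ⟶ N) (hf : Function.Injective (lin f))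
    (k : Q ⟶ N) (hk : LinearMap.range (lin k) ≤ LinearMap.range (lin f)) :
    lift f hf k hk ≫ f = k :=
  hom_ext (LinearMap.comp_codLift _ _ hf _)

/-- The isomorphism between two comodules embedded in a third one with the same image. -/
noncomputable def isoOfRangeEq {M N P : LeftComod R C} (f : M ⟶ P) (g : N ⟶ P)
    (hf : Function.Injective (lin f)) (hg : Function.Injective (lin g))
    (h : LinearMap.range (lin f) = LinearMap.range (lin g)) : M ≅ N where
  hom := lift g hg f h.le
  inv := lift f hf g h.ge
  hom_inv_id := by
    have := mono_of_injective f hf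
    rw [← cancel_mono f, Category.assoc, lift_comp, lift_comp, Category.id_comp]
  inv_hom_id := by
    have := mono_of_injective g hg
    rw [← cancel_mono g, Category.assoc, lift_comp, lift_comp, Category.id_comp]

theorem isoOfRangeEq_hom_comp {M N P : LeftComod R C} (f : M ⟶ P) (g : N ⟶ P)
    (hf : Function.Injective (lin f)) (hg : Function.Injective (lin g))
    (h : LinearMap.range (lin f) = LinearMap.range (lin g)) :
    (isoOfRangeEq f g hf hg h).hom ≫ g = f :=
  lift_comp g hg f h.le

end Lift

end LeftComod

end LeftComodules

theorem range_comp_eq_ker_inf_ker {R M₁ M₂ M₃ N₂ N₃ P : Type*} [Ring R]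
    [AddCommGroup M₁] [Module R M₁] [AddCommGroup M₂] [Module R M₂] [AddCommGroup M₃] [Module R M₃]
    [AddCommGroup N₂] [Module R N₂] [AddCommGroup N₃] [Module R N₃] [AddCommGroup P] [Module R P]
    {k : M₁ →ₗ[R] M₂} {c : M₂ →ₗ[R] M₃} {f : M₂ →ₗ[R] N₂} {j : M₃ →ₗ[R] N₃} {a : N₂ →ₗ[R] N₃}
    {g : N₂ →ₗ[R] P} (hk : Function.Exact k c) (hf : Function.Exact f g)
    (hj : Function.Injective j) (comm : a ∘ₗ f = j ∘ₗ c) :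
    LinearMap.range (f ∘ₗ k) = LinearMap.ker a ⊓ LinearMap.ker g := by
  have ker_eq : LinearMap.ker c = (LinearMap.ker a).comap f := by
    rw [← LinearMap.ker_comp, comm, LinearMap.ker_comp_of_ker_eq_bot _ (LinearMap.ker_eq_bot.2 hj)]
  rw [LinearMap.range_comp, ← hk.linearMap_ker_eq, ker_eq, Submodule.map_comap_eq,
    hf.linearMap_ker_eq, inf_comm]

section Cotensor

variable {R C D : Type u} [CommRing R] [AddCommGroup C] [Module R C] [Coalgebra R C]
  [AddCommGroup D] [Module R D] [Coalgebra R D]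

theorem cotensorMap_rTensor {M N : RightComod R D} (f : M ⟶ N) (P : LeftComod R D) :
    cotensorMap N P ∘ₗ (RightComod.lin f).rTensor P.carrier =
      (RightComod.lin f).rTensor (D ⊗[R] P.carrier) ∘ₗ cotensorMap M P := by
  rw [cotensorMap, cotensorMap, LinearMap.sub_comp, LinearMap.comp_sub, LinearMap.comp_assoc,
    ← LinearMap.rTensor_comp, RightComod.lin_colinear, LinearMap.rTensor_comp]
  congr 1 <;> simp only [coassoc_simps]

theorem cotensorMap_tensorRight (W : Type u) [AddCommGroup W] [Module R W] (M : RightComod R D)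
    (P : LeftComod R D) :
    (TensorProduct.assoc R W M.carrier (D ⊗[R] P.carrier)).toLinearMap ∘ₗ
        cotensorMap (tensorRight W M) P =
      (cotensorMap M P).lTensor W ∘ₗ
        (TensorProduct.assoc R W M.carrier P.carrier).toLinearMap := by
  refine TensorProduct.ext_threefold fun w m p ↦ ?_
  change TensorProduct.assoc R W M.carrier (D ⊗[R] P.carrier)
      (TensorProduct.assoc R (W ⊗[R] M.carrier) D P.carrier
        ((TensorProduct.assoc R W M.carrier D).symm (w ⊗ₜ M.coaction.map m) ⊗ₜ p) -
        (w ⊗ₜ m) ⊗ₜ P.coaction.map p) =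
    w ⊗ₜ (TensorProduct.assoc R M.carrier D P.carrier (M.coaction.map m ⊗ₜ p) -
      m ⊗ₜ P.coaction.map p)
  rw [map_sub, TensorProduct.tmul_sub]
  congr 1
  induction M.coaction.map m with
  | zero => simp only [TensorProduct.zero_tmul, TensorProduct.tmul_zero, map_zero]
  | add s t hs ht => simp only [TensorProduct.add_tmul, TensorProduct.tmul_add, map_add, hs, ht]
  | tmul m d => rfl

theorem cotensorHom_tensorRight_assocHom (W : Type u) [AddCommGroup W] [Module R W]
    (V : RightComod R C) (X : Bicomod R C D) :
    cotensorHom (tensorRight W V) X ≫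
        RightComod.assocHom W V.carrier (tensorRight C X.right) =
      RightComod.assocHom W V.carrier X.right ≫ RightComod.lTensorHom W (cotensorHom V X) :=
  RightComod.hom_ext (cotensorMap_tensorRight W V X.toLeft)

theorem cotensorMap_tensor (M : RightComod R D) (P : LeftComod R D) (V : Type u) [AddCommGroup V]
    [Module R V] :
    cotensorMap M (P.tensor V) ∘ₗ (TensorProduct.assoc R M.carrier P.carrier V).toLinearMap =
      ((TensorProduct.assoc R D P.carrier V).toLinearMap.lTensor M.carrier ∘ₗ
          (TensorProduct.assoc R M.carrier (D ⊗[R] P.carrier) V).toLinearMap) ∘ₗ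
        (cotensorMap M P).rTensor V := by
  refine TensorProduct.ext_threefold fun m p v ↦ ?_
  change TensorProduct.assoc R M.carrier D (P.carrier ⊗[R] V) (M.coaction.map m ⊗ₜ (p ⊗ₜ v)) -
      m ⊗ₜ TensorProduct.assoc R D P.carrier V (P.coaction.map p ⊗ₜ v) =
    (TensorProduct.assoc R D P.carrier V).toLinearMap.lTensor M.carrier
      (TensorProduct.assoc R M.carrier (D ⊗[R] P.carrier) V
        ((TensorProduct.assoc R M.carrier D P.carrier (M.coaction.map m ⊗ₜ p) -
          m ⊗ₜ P.coaction.map p) ⊗ₜ v))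
  rw [TensorProduct.sub_tmul, map_sub, map_sub]
  congr 1
  induction M.coaction.map m with
  | zero => simp only [TensorProduct.zero_tmul, map_zero]
  | add s t hs ht => simp only [TensorProduct.add_tmul, map_add, hs, ht]
  | tmul m d => rfl

theorem exact_cotensorMap_tensor {A : Type u} [AddCommGroup A] [Module R A] {M : RightComod R D}
    {P : LeftComod R D} {V : Type u} [AddCommGroup V] [Module R V]
    {f : A →ₗ[R] (M.carrier ⊗[R] P.carrier) ⊗[R] V}
    (hf : Function.Exact f ((cotensorMap M P).rTensor V)) :
    Function.Exact ((TensorProduct.assoc R M.carrier P.carrier V).toLinearMap ∘ₗ f)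
      (cotensorMap M (P.tensor V)) :=
  (Function.Exact.iff_of_ladder_linearEquiv (e₁ := LinearEquiv.refl R A)
    (e₂ := TensorProduct.assoc R M.carrier P.carrier V)
    (e₃ := TensorProduct.assoc R M.carrier (D ⊗[R] P.carrier) V ≪≫ₗ
      (TensorProduct.assoc R D P.carrier V).lTensor M.carrier)
    rfl (cotensorMap_tensor M P V)).2 hf

instance (X : Bicomod R C D) [Module.Flat R C] : (cotensorFunctor X).Additive where
  map_add {_ _ f g} := LeftComod.hom_ext <| LinearMap.ext fun z ↦ Subtype.ext <|
    LinearMap.congr_fun (LinearMap.lTensor_add X.right.carrier f.1 g.1) z.1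

instance (X : Bicomod R C D) [Module.Flat R C] : (cotensorFunctor X).Linear R where
  map_smul f r := LeftComod.hom_ext <| LinearMap.ext fun z ↦ Subtype.ext <|
    LinearMap.congr_fun (LinearMap.lTensor_smul X.right.carrier r f.1) z.1

section Inclusion

variable [Module.Flat R C]

/-- The inclusion `X □ P → X ⊗ P` as a colinear map. -/
noncomputable def cotensorι (X : Bicomod R C D) (P : LeftComod R D) :
    cotensorObj X P ⟶ X.toLeft.tensor P.carrier :=
  ⟨(cotensor X.right P).subtype, (lTensor_comp_kerMap _ _ _ (cotensorMap_colinear X P)).symm⟩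

variable [Module.Flat R D]

/-- The inclusion `X □ (Y □ N) → X ⊗ (Y ⊗ N)` as a colinear map. -/
noncomputable def cotensorCotensorι (X : Bicomod R C D) (Y : Bicomod R D C) (N : LeftComod R C) :
    (cotensorFunctor X).obj ((cotensorFunctor Y).obj N) ⟶
      X.toLeft.tensor (Y.right.carrier ⊗[R] N.carrier) :=
  cotensorι X (cotensorObj Y N) ≫ X.toLeft.lTensorHom (LeftComod.lin (cotensorι Y N))

theorem cotensorCotensorι_natural (X : Bicomod R C D) (Y : Bicomod R D C) {M N : LeftComod R C}
    (f : M ⟶ N) :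
    (cotensorFunctor X).map ((cotensorFunctor Y).map f) ≫ cotensorCotensorι X Y N =
      cotensorCotensorι X Y M ≫
        X.toLeft.lTensorHom ((LeftComod.lin f).lTensor Y.right.carrier) := by
  have h : (cotensor Y.right N).subtype.lTensor X.right.carrier ∘ₗ
      (cotensorLin Y.right f).lTensor X.right.carrier =
      ((LeftComod.lin f).lTensor Y.right.carrier).lTensor X.right.carrier ∘ₗ
        (cotensor Y.right M).subtype.lTensor X.right.carrier := by
    rw [← LinearMap.lTensor_comp, ← LinearMap.lTensor_comp]
    rfl
  exact LeftComod.hom_ext (LinearMap.ext fun z ↦ LinearMap.congr_fun h z.1)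

variable (X : Bicomod R C D) [Module.Flat R X.right.carrier] (Y : Bicomod R D C)
  (N : LeftComod R C)

theorem cotensorCotensorι_injective :
    Function.Injective (LeftComod.lin (cotensorCotensorι X Y N)) :=
  (lTensor_subtype_injective (cotensor Y.right N)).comp
    (cotensor X.right (cotensorObj Y N)).injective_subtype

theorem range_cotensorCotensorι :
    LinearMap.range (LeftComod.lin (cotensorCotensorι X Y N)) =
      LinearMap.ker (cotensorMap X.right (Y.toLeft.tensor N.carrier)) ⊓
        LinearMap.ker ((cotensorMap Y.right N).lTensor X.right.carrier) :=
  range_comp_eq_ker_inf_ker (LinearMap.exact_subtype_ker_map _)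
    (Module.Flat.lTensor_exact X.right.carrier
      (LinearMap.exact_subtype_ker_map (cotensorMap Y.right N)))
    (Module.Flat.lTensor_preserves_injective_linearMap _
      (lTensor_subtype_injective (C := D) (cotensor Y.right N)))
    (cotensorMap_natural X.right (cotensorι Y N))

end Inclusion

/-- A right colinear map `α : C → X ⊗ Y` which is left colinear and which, after tensoring with
any `R`-module, identifies `C` with the kernel `X □ Y` of `X ⊗ Y → X ⊗ D ⊗ Y`. -/
structure IsCotensorUnit (X : Bicomod R C D) (Y : Bicomod R D C)
    (α : regular R C ⟶ tensorRight X.right.carrier Y.right) : Prop where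
  left_colinear : (X.left.tensor Y.right.carrier).map ∘ₗ RightComod.lin α =
    (RightComod.lin α).lTensor C ∘ₗ Coalgebra.comul
  injective (V : Type u) [AddCommGroup V] [Module R V] :
    Function.Injective ((RightComod.lin α).rTensor V)
  exact (V : Type u) [AddCommGroup V] [Module R V] :
    Function.Exact ((RightComod.lin α).rTensor V) ((cotensorMap X.right Y.toLeft).rTensor V)

namespace IsCotensorUnit

variable {X : Bicomod R C D} {Y : Bicomod R D C}
  {α : regular R C ⟶ tensorRight X.right.carrier Y.right} (h : IsCotensorUnit X Y α)

/-- The unit `α` as a map of left comodules. -/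
def leftHom : (regularBicomod R C).toLeft ⟶ X.toLeft.tensor Y.right.carrier :=
  ⟨RightComod.lin α, h.left_colinear⟩

/-- The colinear map `N → X ⊗ (Y ⊗ N)`, the composite of `ρ_N` and `α ⊗ id_N`. -/
def unitHom (N : LeftComod R C) : N ⟶ X.toLeft.tensor (Y.right.carrier ⊗[R] N.carrier) :=
  N.coactionHom ≫ LeftComod.rTensorHom N.carrier h.leftHom ≫
    X.toLeft.assocHom Y.right.carrier N.carrier

theorem lin_unitHom (N : LeftComod R C) :
    LeftComod.lin (h.unitHom N) =
      ((TensorProduct.assoc R X.right.carrier Y.right.carrier N.carrier).toLinearMap ∘ₗ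
        (RightComod.lin α).rTensor N.carrier) ∘ₗ N.coaction.map := rfl

theorem unitHom_natural {M N : LeftComod R C} (f : M ⟶ N) :
    f ≫ h.unitHom N =
      h.unitHom M ≫ X.toLeft.lTensorHom ((LeftComod.lin f).lTensor Y.right.carrier) := by
  refine LeftComod.hom_ext ?_
  change LeftComod.lin (h.unitHom N) ∘ₗ LeftComod.lin f =
    ((LeftComod.lin f).lTensor Y.right.carrier).lTensor X.right.carrier ∘ₗ
      LeftComod.lin (h.unitHom M)
  rw [lin_unitHom, lin_unitHom, LinearMap.comp_assoc, LeftComod.lin_colinear,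
    ← LinearMap.comp_assoc, ← LinearMap.comp_assoc]
  congr 1
  simp only [coassoc_simps]

theorem unitHom_injective (N : LeftComod R C) : Function.Injective (LeftComod.lin (h.unitHom N)) :=
  ((TensorProduct.assoc R X.right.carrier Y.right.carrier N.carrier).injective.comp
    (h.injective N.carrier)).comp N.coaction_injective

theorem range_unitHom (N : LeftComod R C) :
    LinearMap.range (LeftComod.lin (h.unitHom N)) =
      LinearMap.ker ((cotensorMap Y.right N).lTensor X.right.carrier) ⊓
        LinearMap.ker (cotensorMap X.right (Y.toLeft.tensor N.carrier)) := by
  have comm : (cotensorMap Y.right N).lTensor X.right.carrier ∘ₗ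
      (TensorProduct.assoc R X.right.carrier Y.right.carrier N.carrier).toLinearMap ∘ₗ
        (RightComod.lin α).rTensor N.carrier =
      ((TensorProduct.assoc R X.right.carrier Y.right.carrier (C ⊗[R] N.carrier)).toLinearMap ∘ₗ
        (RightComod.lin α).rTensor (C ⊗[R] N.carrier)) ∘ₗ cotensorMap (regular R C) N := by
    rw [← LinearMap.comp_assoc, ← cotensorMap_tensorRight, LinearMap.comp_assoc,
      cotensorMap_rTensor, LinearMap.comp_assoc]
  have exact_right : Function.Exact
      ((TensorProduct.assoc R X.right.carrier Y.right.carrier N.carrier).toLinearMap ∘ₗ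
        (RightComod.lin α).rTensor N.carrier)
      (cotensorMap X.right (Y.toLeft.tensor N.carrier)) :=
    exact_cotensorMap_tensor (P := Y.toLeft) (h.exact N.carrier)
  have inj : Function.Injective
      ((TensorProduct.assoc R X.right.carrier Y.right.carrier (C ⊗[R] N.carrier)).toLinearMap ∘ₗ
        (RightComod.lin α).rTensor (C ⊗[R] N.carrier)) :=
    (TensorProduct.assoc R X.right.carrier Y.right.carrier (C ⊗[R] N.carrier)).injective.comp
      (h.injective (C ⊗[R] N.carrier))
  rw [lin_unitHom]
  exact range_comp_eq_ker_inf_ker N.exact_coaction exact_right inj comm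

variable [Module.Flat R C] [Module.Flat R D] [Module.Flat R X.right.carrier]

/-- The isomorphism `N ≅ X □ (Y □ N)` of two subcomodules of `X ⊗ (Y ⊗ N)`. -/
noncomputable def iso (N : LeftComod R C) :
    N ≅ (cotensorFunctor X).obj ((cotensorFunctor Y).obj N) :=
  LeftComod.isoOfRangeEq (h.unitHom N) (cotensorCotensorι X Y N) (h.unitHom_injective N)
    (cotensorCotensorι_injective X Y N)
    (by rw [h.range_unitHom, range_cotensorCotensorι, inf_comm])

theorem iso_hom_comp (N : LeftComod R C) :
    (h.iso N).hom ≫ cotensorCotensorι X Y N = h.unitHom N :=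
  LeftComod.isoOfRangeEq_hom_comp ..

theorem iso_hom_natural {M N : LeftComod R C} (f : M ⟶ N) :
    f ≫ (h.iso N).hom =
      (h.iso M).hom ≫ (cotensorFunctor X).map ((cotensorFunctor Y).map f) := by
  have := LeftComod.mono_of_injective _ (cotensorCotensorι_injective X Y N)
  rw [← cancel_mono (cotensorCotensorι X Y N), Category.assoc, Category.assoc, h.iso_hom_comp,
    cotensorCotensorι_natural, ← Category.assoc, h.iso_hom_comp, h.unitHom_natural]

/-- The natural isomorphism `N ≅ X □ (Y □ N)`. -/
noncomputable def unitIso : 𝟭 (LeftComod R C) ≅ cotensorFunctor Y ⋙ cotensorFunctor X :=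
  NatIso.ofComponents h.iso h.iso_hom_natural

end IsCotensorUnit

end Cotensor

section Equivalence

variable {R C D : Type u} [CommRing R] [AddCommGroup C] [Module R C] [Coalgebra R C]
  [AddCommGroup D] [Module R D] [Coalgebra R D]

open RightComod

theorem flat_obj [Module.Flat R D] (F : RightComod R C ⥤ RightComod R D) [F.Additive]
    [F.Linear R] [F.IsEquivalence] (M : RightComod R C) [Module.Flat R M.carrier] :
    Module.Flat R (F.obj M).carrier := by
  refine Module.Flat.iff_rTensor_preserves_injective_linearMap.2 fun W V _ _ _ _ f hf ↦ ?_
  have inj : Function.Injective (lin (F.map (rTensorHom f M))) :=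
    injective_map F _ (Module.Flat.rTensor_preserves_injective_linearMap f hf)
  have comm : lam F V M ∘ₗ f.rTensor (F.obj M).carrier =
      lin (F.map (rTensorHom f M)) ∘ₗ lam F W M := congrArg lin (rTensorHom_lamHom F f M)
  refine Function.Injective.of_comp (f := lam F V M) ?_
  rw [← LinearMap.coe_comp, comm]
  exact inj.comp (lam_bijective F W M).injective

variable (F : RightComod R C ⥤ RightComod R D)
  (G : RightComod R D ⥤ RightComod R C) [G.Additive] [G.Linear R]
  (η : 𝟭 (RightComod R C) ≅ F ⋙ G)

section Embedding

variable [G.IsEquivalence]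

/-- The unit `C ≅ GF(C)` followed by the embedding of `GF(C)` into `F(C) ⊗ G(D)`. -/
noncomputable def cotensorUnit :
    regular R C ⟶ tensorRight (F.obj (regular R C)).carrier (G.obj (regular R D)) :=
  η.hom.app (regular R C) ≫ toTensor G (F.obj (regular R C))

theorem lTensorHom_cotensorUnit (W : Type u) [AddCommGroup W] [Module R W] :
    lTensorHom W (cotensorUnit F G η) =
      (lTensorHom W (η.hom.app (regular R C)) ≫ lamHom G W (F.obj (regular R C))) ≫
        toTensor G (tensorRight W (F.obj (regular R C))) ≫
          assocHom W (F.obj (regular R C)).carrier (G.obj (regular R D)) := by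
  rw [Category.assoc, lamHom_toTensor]
  exact lTensorHom_comp (η.hom.app (regular R C)) (toTensor G (F.obj (regular R C)))

theorem lTensorHom_cotensorUnit_injective [Module.Flat R C] (W : Type u) [AddCommGroup W]
    [Module R W] :
    Function.Injective (lin (lTensorHom W (cotensorUnit F G η))) := by
  rw [lTensorHom_cotensorUnit]
  exact ((bijective_of_isIso (assocHom _ _ _)).injective.comp
    (toTensor_injective G _)).comp (bijective_of_isIso (_ ≫ _)).injective

theorem exact_lTensorHom_cotensorUnit [Module.Flat R C] [Module.Flat R D] (W : Type u)
    [AddCommGroup W] [Module R W] :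
    Function.Exact (lin (lTensorHom W (cotensorUnit F G η)))
      (lin (lTensorHom W
        (cotensorHom (F.obj (regular R C)) (mapBicomod G (regularBicomod R D))))) :=
  (exact_iff_of_iso
    (inv (lTensorHom W (η.hom.app (regular R C)) ≫ lamHom G W (F.obj (regular R C))))
    (assocHom W (F.obj (regular R C)).carrier (G.obj (regular R D)))
    (assocHom W (F.obj (regular R C)).carrier (tensorRight D (G.obj (regular R D))))
    (by rw [IsIso.inv_comp_eq, lTensorHom_cotensorUnit])
    (cotensorHom_tensorRight_assocHom W (F.obj (regular R C))
      (mapBicomod G (regularBicomod R D))).symm).2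
    (exact_toTensor G (tensorRight W (F.obj (regular R C))))

end Embedding

variable [F.Additive] [F.Linear R]

theorem lTensorHom_unit_lamHom_lamHom (W : Type u) [AddCommGroup W] [Module R W]
    (M : RightComod R C) :
    lTensorHom W (η.hom.app M) ≫ lamHom G W (F.obj M) ≫ G.map (lamHom F W M) =
      η.hom.app (tensorRight W M) := by
  refine tensorRight_hom_ext fun w ↦ ?_
  rw [reassoc_of% insertion_lTensorHom]
  change η.hom.app M ≫ insertion W (G.obj (F.obj M)) w ≫ _ = insertion W M w ≫ _
  rw [reassoc_of% insertion_lamHom, ← G.map_comp, insertion_lamHom]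
  exact (η.hom.naturality (insertion W M w)).symm

variable [F.IsEquivalence] [G.IsEquivalence]

theorem cotensorUnit_left_colinear :
    cotensorUnit F G η ≫ rTensorHom (lin (mapLeftHom F (regularBicomod R C)))
        (G.obj (regular R D)) ≫ assocHom C _ (G.obj (regular R D)) =
      comulHom R C ≫ lTensorHom C (cotensorUnit F G η) := by
  have unit_coaction : η.hom.app (regular R C) ≫ G.map (mapLeftHom F (regularBicomod R C)) =
      comulHom R C ≫ lTensorHom C (η.hom.app (regular R C)) ≫
        lamHom G C (F.obj (regular R C)) := by
    rw [← cancel_mono (G.map (lamHom F C (regular R C)))]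
    simp only [Category.assoc]
    rw [lTensorHom_unit_lamHom_lamHom, ← G.map_comp, mapLeftHom_lamHom]
    exact (η.hom.naturality (comulHom R C)).symm
  rw [cotensorUnit, Category.assoc, ← reassoc_of% toTensor_natural,
    reassoc_of% unit_coaction, lamHom_toTensor, lTensorHom_comp]

theorem isCotensorUnit_cotensorUnit [Module.Flat R C] [Module.Flat R D] :
    IsCotensorUnit (mapBicomod F (regularBicomod R C)) (mapBicomod G (regularBicomod R D))
      (cotensorUnit F G η) where
  left_colinear := congrArg lin (cotensorUnit_left_colinear F G η)
  injective V _ _ := (LinearMap.lTensor_inj_iff_rTensor_inj V _).1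
    (lTensorHom_cotensorUnit_injective F G η V)
  exact V _ _ := (LinearMap.rTensor_exact_iff_lTensor_exact V).2
    (exact_lTensorHom_cotensorUnit F G η V)

end Equivalence

end MoritaTakeuchi

open MoritaTakeuchi in
theorem mainTheorem4 {R C D : Type u} [CommRing R]
    [AddCommGroup C] [Module R C] [Coalgebra R C] [Module.Flat R C]
    [AddCommGroup D] [Module R D] [Coalgebra R D] [Module.Flat R D]
    (e : RightComod R C ≌ RightComod R D) [e.functor.Additive] [e.functor.Linear R] :
    Function.Bijective (lam e.functor C (regular R C)) ∧
    Function.Bijective (lam e.inverse D (regular R D)) ∧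
    ∃ (l : LeftCoaction R C (e.functor.obj (regular R C)).carrier)
      (hl : Compatible l (e.functor.obj (regular R C)).coaction)
      (l' : LeftCoaction R D (e.inverse.obj (regular R D)).carrier)
      (hl' : Compatible l' (e.inverse.obj (regular R D)).coaction),
      lam e.functor C (regular R C) ∘ₗ l.map =
        RightComod.lin (e.functor.map (comulHom R C)) ∧
      lam e.inverse D (regular R D) ∘ₗ l'.map =
        RightComod.lin (e.inverse.map (comulHom R D)) ∧
      ∃ E : LeftComod R D ≌ LeftComod R C,
        E.functor = cotensorFunctor ⟨e.functor.obj (regular R C), l, hl⟩ ∧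
        E.inverse = cotensorFunctor ⟨e.inverse.obj (regular R D), l', hl'⟩ ∧
        E.functor.Additive ∧ E.functor.Linear R := by
  have : Module.Flat R (mapBicomod e.functor (regularBicomod R C)).right.carrier :=
    flat_obj e.functor (regular R C)
  have : Module.Flat R (mapBicomod e.inverse (regularBicomod R D)).right.carrier :=
    flat_obj e.inverse (regular R D)
  exact ⟨lam_bijective e.functor _ _, lam_bijective e.inverse _ _,
    (mapBicomod e.functor (regularBicomod R C)).left,
    (mapBicomod e.functor (regularBicomod R C)).compatible,
    (mapBicomod e.inverse (regularBicomod R D)).left,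
    (mapBicomod e.inverse (regularBicomod R D)).compatible,
    lam_comp_mapBicomod_left e.functor (regularBicomod R C),
    lam_comp_mapBicomod_left e.inverse (regularBicomod R D),
    .mk (cotensorFunctor (mapBicomod e.functor (regularBicomod R C)))
      (cotensorFunctor (mapBicomod e.inverse (regularBicomod R D)))
      (isCotensorUnit_cotensorUnit e.inverse e.functor e.counitIso.symm).unitIso
      (isCotensorUnit_cotensorUnit e.functor e.inverse e.unitIso).unitIso.symm,
    rfl, rfl, inferInstanceAs (cotensorFunctor _).Additive,
    inferInstanceAs ((cotensorFunctor _).Linear R)⟩
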